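/- Let $V$ be an infinite set of values. All languages below are sets of words over $V$. A language $L$ is *uniform-length* if all its words have the same length, and it *has disjoint positions* if for all $a_1\cdots a_k,\ b_1\cdots b_k\in L$ and all $i\neq j$ we have $a_i\neq b_j$. Consider the following models, each object of which represents a language and has a size. * CFG: context-free grammars over $V$ (finitely many rules). The size of a grammar is the sum, over its nonterminals $A$ with rules $A\to\alpha_1\cup\dots\cup\alpha_m$, of the number of occurrences of symbols plus the number of occurrences of operators (concatenation, union) in $\alpha_1\cup\dots\cup\alpha_m$, where $\varepsilon$ counts as one symbol. UCFG: the CFGs $G$ that are unambiguous, i.e. every word of $L(G)$ has exactly one derivation tree. * NFA: nondeterministic finite automata with finitely many states and transitions $p\xrightarrow{a}q$ ($a\in V$), a set of initial states and a set of accepting states; the size is the number of states plus the number of transitions. UFA: the NFAs in which every accepted word has exactly one accepting run. DFA: the NFAs with exactly one initial state and, for each state $p$ and each $a\in V$, at most one transition $p\xrightarrow{a}q$. * Set: finite sets $S$ of words, listed explicitly; the size is $\sum_{w\in S}(|w|+1)$. For models $X,Y$ and $f:\mathbb N\to\mathbb R$, there is an *$f(n)$-size translation* from $X$ to $Y$ (over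 uniform-length languages with disjoint positions) if there is a constant $C>0$ such that for every object $x$ of $X$ whose language is uniform-length and has disjoint positions there is an object of $Y$ with the same language and of size at most $C\cdot f(|x|)$. It is *tight* if in addition there are a constant $c>0$ and a family of such objects $x$ of $X$, of infinitely many different sizes, such that every object of $Y$ with the same language as $x$ has size at least $c\cdot f(|x|)$. **Theorem.** There are exponential translations, that is, $f(n)$-size translations for functions $f(n)=2^{\Theta(n)}$ (one function for each case), * (E1) from CFG to NFA; * (E2) from UCFG to UFA; * (E3) from CFG to UCFG; * (E4) from NFA to UCFG; * (E5) from NFA to UFA; * (E6) from UFA to DFA; * (E7) from DFA to Set; and * (E8) from CFG to Set. Furthermore, for (E1), (E2), (E7) and (E8) there is a function $f(n)=2^{\Theta(n)}$ for which there is a tight $f(n)$-size translation; and for (E5) and (E6) there is a function $f(n)=2^{n^{\Theta(1)}}$ for which there is a tight $f(n)$-size translation. -/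

import Mathlib

open Filter

universe u w w₁ w₂

namespace SizeTradeoff

/-! ### Languages -/

/-- All words of `L` have the same length. -/
def UniformLength {V : Type u} (L : Language V) : Prop :=
  ∃ k : ℕ, ∀ a ∈ L, a.length = k

/-- No value occurs at two different positions, in the same word or in two different words. -/
def DisjointPositions {V : Type u} (L : Language V) : Prop :=
  ∀ a ∈ L, ∀ b ∈ L, ∀ (i : Fin a.length) (j : Fin b.length), (i : ℕ) ≠ (j : ℕ) → a.get i ≠ b.get j

/-! ### Representation models, size translations and tightness -/

/-- A class of objects, each with the language it represents and its size. -/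
structure Model (V : Type u) where
  Obj : Type w
  lang : Obj → Language V
  size : Obj → ℕ

/-- The object represents a uniform-length language with disjoint positions. -/
def Model.Admissible {V : Type u} (X : Model.{u, w} V) (x : X.Obj) : Prop :=
  UniformLength (X.lang x) ∧ DisjointPositions (X.lang x)

/-- There is an `f(n)`-size translation from `X` to `Y`, over uniform-length languages with
disjoint positions: each object of size `n` in `X` has an equivalent object of size `O(f(n))`. -/
def SizeTranslation {V : Type u} (X : Model.{u, w₁} V) (Y : Model.{u, w₂} V) (f : ℕ → ℝ) : Prop :=
  ∃ C : ℝ, 0 < C ∧ ∀ x : X.Obj, X.Admissible x →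
    ∃ y : Y.Obj, Y.lang y = X.lang x ∧ (Y.size y : ℝ) ≤ C * f (X.size x)

/-- There is an infinite family of objects of `X` (with unboundedly many sizes) in which, for each
object of size `n`, every equivalent object of `Y` has size `Ω(f(n))`. -/
def SizeLowerBound {V : Type u} (X : Model.{u, w₁} V) (Y : Model.{u, w₂} V) (f : ℕ → ℝ) : Prop :=
  ∃ c : ℝ, 0 < c ∧ ∃ F : Set X.Obj, (X.size '' F).Infinite ∧ ∀ x ∈ F, X.Admissible x ∧
    ∀ y : Y.Obj, Y.lang y = X.lang x → c * f (X.size x) ≤ (Y.size y : ℝ)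

/-- For a set `𝓕` of functions, there is an `𝓕`-translation from `X` to `Y`. -/
def HasTranslation {V : Type u} (𝓕 : Set (ℕ → ℝ)) (X : Model.{u, w₁} V) (Y : Model.{u, w₂} V) :
    Prop :=
  ∃ f ∈ 𝓕, SizeTranslation X Y f

/-- For a set `𝓕` of functions, there is a tight `𝓕`-translation from `X` to `Y`: the same function
is an upper bound for all objects and a lower bound on an infinite family. -/
def HasTightTranslation {V : Type u} (𝓕 : Set (ℕ → ℝ)) (X : Model.{u, w₁} V)
    (Y : Model.{u, w₂} V) : Prop :=
  ∃ f ∈ 𝓕, SizeTranslation X Y f ∧ SizeLowerBound X Y f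

/-- The functions in `2 ^ Θ(n)`. -/
def linExp : Set (ℕ → ℝ) :=
  {f | ∃ c C : ℝ, 0 < c ∧ ∀ᶠ n : ℕ in atTop,
    (2 : ℝ) ^ (c * (n : ℝ)) ≤ f n ∧ f n ≤ (2 : ℝ) ^ (C * (n : ℝ))}

/-- The functions in `2 ^ (n ^ Θ(1))`. -/
def polyExp : Set (ℕ → ℝ) :=
  {f | ∃ c C : ℝ, 0 < c ∧ ∀ᶠ n : ℕ in atTop,
    (2 : ℝ) ^ ((n : ℝ) ^ c) ≤ f n ∧ f n ≤ (2 : ℝ) ^ ((n : ℝ) ^ C)}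

/-! ### Context-free grammars -/

/-- The size of the regular expression that is the concatenation of the symbols of `α`: the number
of symbols plus the number of concatenation operators; the expression `ε` has size 1. -/
def concatSize {S : Type*} (α : List S) : ℕ :=
  max 1 (2 * α.length - 1)

open Classical in
/-- The size of a grammar: the sum, over the nonterminals `A` with rules
`A → α₁ ∪ ⋯ ∪ αₘ`, of the number of occurrences of symbols and operators in `α₁ ∪ ⋯ ∪ αₘ`.
The total number of union operators is the number of pairs `(A, αᵢ)` minus the number of distinct
left-hand sides. -/
noncomputable def cfgSize {V : Type u} (G : ContextFreeGrammar V) : ℕ :=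
  (∑ r ∈ G.rules, concatSize r.output) +
    (G.rules.card - (G.rules.image ContextFreeRule.input).card)

/-- Ordered forests of (complete) derivation trees of `G` whose roots spell the given word. -/
inductive DerivForest {V : Type u} (G : ContextFreeGrammar V) :
    List (Symbol V G.NT) → Type u
  | nil : DerivForest G []
  | terminal (a : V) {s : List (Symbol V G.NT)} (rest : DerivForest G s) :
      DerivForest G (Symbol.terminal a :: s)
  | nonterminal (A : G.NT) (α : List (Symbol V G.NT)) (h : ContextFreeRule.mk A α ∈ G.rules)
      {s : List (Symbol V G.NT)} (children : DerivForest G α) (rest : DerivForest G s) :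
      DerivForest G (Symbol.nonterminal A :: s)

/-- The word of terminals at the leaves, from left to right. -/
def DerivForest.yield {V : Type u} {G : ContextFreeGrammar V} :
    {s : List (Symbol V G.NT)} → DerivForest G s → List V
  | _, .nil => []
  | _, .terminal a rest => a :: rest.yield
  | _, .nonterminal _ _ _ children rest => children.yield ++ rest.yield

/-- Derivation trees whose root is the start symbol. -/
abbrev DerivTree {V : Type u} (G : ContextFreeGrammar V) : Type u :=
  DerivForest G [Symbol.nonterminal G.initial]

/-- Every word of the language has a unique derivation tree. -/
def CFGUnambiguous {V : Type u} (G : ContextFreeGrammar V) : Prop :=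
  ∀ a ∈ G.language, ∃! t : DerivTree G, t.yield = a

/-- Context-free grammars. -/
noncomputable def CFG (V : Type u) : Model V where
  Obj := ContextFreeGrammar V
  lang := fun G => G.language
  size := cfgSize

/-- Unambiguous context-free grammars. -/
noncomputable def UCFG (V : Type u) : Model V where
  Obj := {G : ContextFreeGrammar V // CFGUnambiguous G}
  lang := fun G => G.1.language
  size := fun G => cfgSize G.1

/-! ### Finite automata -/

/-- A nondeterministic finite automaton: finitely many states and finitely many transitions
`p --a--> q`, with sets of initial and of accepting states. -/
structure FinAutomaton (V : Type u) where
  State : Type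
  [fintypeState : Fintype State]
  aut : NFA V State
  finite_transitions : {t : State × V × State | t.2.2 ∈ aut.step t.1 t.2.1}.Finite

/-- Number of states plus number of transitions. -/
noncomputable def FinAutomaton.size {V : Type u} (A : FinAutomaton V) : ℕ :=
  Nat.card A.State + {t : A.State × V × A.State | t.2.2 ∈ A.aut.step t.1 t.2.1}.ncard

/-- Every accepted word has a unique accepting run. -/
def FinAutomaton.Unambiguous {V : Type u} (A : FinAutomaton V) : Prop :=
  ∀ a ∈ A.aut.accepts, ∃! ρ : (p : A.State) × (q : A.State) × A.aut.Path p q a,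
    ρ.1 ∈ A.aut.start ∧ ρ.2.1 ∈ A.aut.accept

/-- One initial state, and at most one transition for each state and symbol. -/
def FinAutomaton.Deterministic {V : Type u} (A : FinAutomaton V) : Prop :=
  (∃ q₀ : A.State, A.aut.start = {q₀}) ∧ ∀ (q : A.State) (a : V), (A.aut.step q a).Subsingleton

/-- Nondeterministic finite automata. -/
noncomputable def NFAs (V : Type u) : Model V where
  Obj := FinAutomaton V
  lang := fun A => A.aut.accepts
  size := fun A => A.size

/-- Unambiguous finite automata. -/
noncomputable def UFAs (V : Type u) : Model V where
  Obj := {A : FinAutomaton V // A.Unambiguous}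
  lang := fun A => A.1.aut.accepts
  size := fun A => A.1.size

/-- Deterministic finite automata (with a partial transition function). -/
noncomputable def DFAs (V : Type u) : Model V where
  Obj := {A : FinAutomaton V // A.Deterministic}
  lang := fun A => A.1.aut.accepts
  size := fun A => A.1.size

/-! ### Explicit sets -/

/-- Finite sets of words, listed explicitly; a word `w` contributes `|w| + 1` to the size. -/
def ExplicitSet (V : Type u) : Model V where
  Obj := Finset (List V)
  lang := fun S => {a : List V | a ∈ S}
  size := fun S => ∑ a ∈ S, (a.length + 1)

end SizeTradeoff

/-!
**Upper bounds.** An object of size `n` involves at most `n` symbols. In a uniform-length language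
with disjoint positions a symbol determines its position, so a word is determined by its set of
symbols (`eq_of_toFinset_eq`); hence there are at most `2 ^ n` words, each of length at most `n`,
and listing them explicitly takes size at most `4 ^ n` (`exists_explicitSet_of_alphabet`). Every
model expresses an explicit list with linear overhead: a grammar with one rule for each word, or
the prefix tree of the words. This gives all translations (`hasTranslation_linExp`).

**Tightness.** A translation is made tight by measuring its worst case: if `g` is a lower bound on
infinitely many sizes, then the maximum of `g` and of the worst-case cost is both an upper bound
and a lower bound on an infinite family (`exists_tight_function`). What remains is one family of
hard languages for each pair of models.

* Grammars to automata, or to explicit sets: palindromes have unambiguous grammars of linear size,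
  while their half-words form a fooling set of size `2 ^ k` (`card_le_of_foolingSet`).
* Deterministic automata to explicit sets: all bit strings of length `k`.
* Nondeterministic to unambiguous automata: the pairs of intersecting subsets of `Fin k`. The
  automaton guesses a common element. In an unambiguous automaton each accepting run passes the cut
  between the two halves in a unique state, which factors the intersection matrix through the set of
  states; this matrix has rank at least `2 ^ k - 1` (`two_pow_le_of_unambiguous`).
* Unambiguous to deterministic automata: the pairs of a subset of `Fin k` and one of its members.
  Here the element guessed is revealed by the last symbol, so the guess is unambiguous; the `2 ^ k`
  subsets have different residual languages (`card_le_of_residuals`).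

The last three languages are unions of products of sets of symbols, recognized by `unionAutomaton`.
-/

namespace SizeTradeoff

/-! ### Words of admissible languages -/

/-- In a uniform-length language with disjoint positions, a word is determined by its set of
symbols, since each symbol determines its position. -/
theorem eq_of_toFinset_eq {V : Type u} [DecidableEq V] {L : Language V} (hu : UniformLength L)
    (hd : DisjointPositions L) {a b : List V} (ha : a ∈ L) (hb : b ∈ L)
    (h : a.toFinset = b.toFinset) : a = b := by
  obtain ⟨k, hk⟩ := hu
  refine List.ext_get ((hk a ha).trans (hk b hb).symm) fun i hi hi' => ?_
  have hmem : a.get ⟨i, hi⟩ ∈ b := by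
    rw [← List.mem_toFinset, ← h, List.mem_toFinset]
    exact List.get_mem _ _
  obtain ⟨j, hj⟩ := List.get_of_mem hmem
  have hij : i = j := by
    by_contra hne
    exact hd a ha b hb ⟨i, hi⟩ j hne hj.symm
  rw [← hj]
  congr 1
  exact Fin.ext hij.symm

theorem DisjointPositions.nodup {V : Type u} {L : Language V} (hd : DisjointPositions L)
    {a : List V} (ha : a ∈ L) : a.Nodup := by
  rw [List.nodup_iff_injective_get]
  intro i j hij
  by_contra hne
  exact hd a ha a ha i j (fun h => hne (Fin.ext h)) hij

/-- A language each of whose symbols knows its own position is uniform-length with disjoint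
positions. -/
theorem uniformLength_and_disjointPositions_of_map_eq_range {V : Type u} {L : Language V}
    (pos : V → ℕ) (k : ℕ) (h : ∀ a ∈ L, a.map pos = List.range k) :
    UniformLength L ∧ DisjointPositions L := by
  refine ⟨⟨k, fun a ha => by simpa using congrArg List.length (h a ha)⟩, ?_⟩
  have key : ∀ a ∈ L, ∀ i : Fin a.length, pos (a.get i) = i := by
    intro a ha i
    have := List.getElem_of_eq (h a ha) (i := i) (by simp)
    simpa using this
  intro a ha b hb i j hij heq
  exact hij (by rw [← key a ha i, ← key b hb j, heq])

/-- An admissible language over `n` symbols has at most `2 ^ n` words, of length at most `n`. -/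
theorem exists_explicitSet_of_alphabet {V : Type u} {L : Language V} (hu : UniformLength L)
    (hd : DisjointPositions L) (T : Finset V) (hT : ∀ a ∈ L, ∀ v ∈ a, v ∈ T) :
    ∃ S : Finset (List V), (∀ a, a ∈ S ↔ a ∈ L) ∧ ∑ a ∈ S, (a.length + 1) ≤ 4 ^ T.card := by
  classical
  have hinj : Set.InjOn List.toFinset {a : List V | a ∈ L} := fun a ha b hb h =>
    eq_of_toFinset_eq hu hd ha hb h
  have hmaps : Set.MapsTo List.toFinset {a : List V | a ∈ L} (T.powerset : Set (Finset V)) := by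
    intro a ha
    simp only [Finset.coe_powerset, Set.mem_preimage, Set.mem_powerset_iff, Finset.coe_subset]
    intro v hv
    exact hT a ha v (List.mem_toFinset.1 hv)
  have hfin : {a : List V | a ∈ L}.Finite :=
    Set.Finite.of_injOn hmaps hinj T.powerset.finite_toSet
  refine ⟨hfin.toFinset, fun a => by simp, ?_⟩
  have hcard : hfin.toFinset.card ≤ 2 ^ T.card := by
    rw [← Finset.card_powerset]
    refine Finset.card_le_card_of_injOn List.toFinset ?_ ?_
    · simpa using hmaps
    · simpa using hinj
  have hlen : ∀ a ∈ hfin.toFinset, a.length + 1 ≤ 2 ^ T.card := by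
    intro a ha
    have haL : a ∈ L := by simpa using ha
    rw [← List.toFinset_card_of_nodup (hd.nodup haL)]
    calc a.toFinset.card + 1 ≤ T.card + 1 := by
          gcongr
          intro v hv
          exact hT a haL v (List.mem_toFinset.1 hv)
      _ ≤ 2 ^ T.card := Nat.lt_two_pow_self
  calc ∑ a ∈ hfin.toFinset, (a.length + 1) ≤ hfin.toFinset.card * 2 ^ T.card := by
        simpa using Finset.sum_le_card_nsmul _ _ _ hlen
    _ ≤ 2 ^ T.card * 2 ^ T.card := by gcongr
    _ = 4 ^ T.card := by rw [← mul_pow]; norm_num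

/-! ### Exponential translations between arbitrary models -/

/-- An object of size `n` represents a language over at most `n` symbols. -/
def Model.AlphabetBounded {V : Type u} (X : Model.{u, w} V) : Prop :=
  ∀ x : X.Obj, ∃ T : Finset V, T.card ≤ X.size x ∧ ∀ a ∈ X.lang x, ∀ v ∈ a, v ∈ T

/-- The model can express every explicitly listed finite set of words with linear overhead. -/
def Model.Expressive {V : Type u} (Y : Model.{u, w} V) : Prop :=
  ∃ C : ℕ, ∀ S : Finset (List V), ∃ y : Y.Obj, (∀ a, a ∈ Y.lang y ↔ a ∈ S) ∧
    Y.size y ≤ C * (∑ a ∈ S, (a.length + 1) + 1)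

/-- All translations factor through the explicit listing of the language, which has size at most
`4 ^ n`. -/
theorem sizeTranslation_four_pow {V : Type u} {X : Model.{u, w₁} V} {Y : Model.{u, w₂} V}
    (hX : X.AlphabetBounded) (hY : Y.Expressive) :
    SizeTranslation X Y (fun n => (4 : ℝ) ^ n) := by
  obtain ⟨C, hC⟩ := hY
  refine ⟨2 * C + 1, by positivity, fun x hx => ?_⟩
  obtain ⟨T, hT, hL⟩ := hX x
  obtain ⟨S, hS, hsize⟩ := exists_explicitSet_of_alphabet hx.1 hx.2 T hL
  obtain ⟨y, hy, hys⟩ := hC S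
  refine ⟨y, Set.ext fun a => (hy a).trans (hS a), ?_⟩
  have h1 : (4 : ℕ) ^ T.card ≤ 4 ^ X.size x := Nat.pow_le_pow_right (by norm_num) hT
  have h2 : 1 ≤ (4 : ℕ) ^ X.size x := Nat.one_le_pow _ _ (by norm_num)
  have h3 : Y.size y ≤ (2 * C + 1) * 4 ^ X.size x :=
    calc Y.size y ≤ C * (∑ a ∈ S, (a.length + 1) + 1) := hys
      _ ≤ C * (4 ^ X.size x + 4 ^ X.size x) := by gcongr; exact hsize.trans h1
      _ ≤ (2 * C + 1) * 4 ^ X.size x := by linarith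
  dsimp only
  exact_mod_cast h3

theorem four_pow_mem_linExp : (fun n : ℕ => (4 : ℝ) ^ n) ∈ linExp := by
  have h : ∀ n : ℕ, (4 : ℝ) ^ n = 2 ^ ((2 : ℝ) * n) := by
    intro n
    rw [Real.rpow_mul (by norm_num), Real.rpow_natCast]
    norm_num
  exact ⟨2, 2, by norm_num, Eventually.of_forall fun n => ⟨(h n).ge, (h n).le⟩⟩

theorem hasTranslation_linExp {V : Type u} {X : Model.{u, w₁} V} {Y : Model.{u, w₂} V}
    (hX : X.AlphabetBounded) (hY : Y.Expressive) : HasTranslation linExp X Y :=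
  ⟨_, four_pow_mem_linExp, sizeTranslation_four_pow hX hY⟩

/-! ### From lower bounds to tight translations -/

/-- The least size of an object of `Y` with the same language as `x`. -/
noncomputable def translationCost {V : Type u} (X : Model.{u, w₁} V) (Y : Model.{u, w₂} V)
    (x : X.Obj) : ℕ :=
  sInf (Y.size '' {y | Y.lang y = X.lang x})

/-- The largest cost of translating an admissible object of size `n`. It is `0` where there is no
such object, and also where the costs are unbounded, which an existing translation excludes. -/
noncomputable def worstCost {V : Type u} (X : Model.{u, w₁} V) (Y : Model.{u, w₂} V) (n : ℕ) : ℕ :=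
  sSup (translationCost X Y '' {x | X.Admissible x ∧ X.size x = n})

theorem translationCost_le {V : Type u} {X : Model.{u, w₁} V} {Y : Model.{u, w₂} V} {x : X.Obj}
    {y : Y.Obj} (h : Y.lang y = X.lang x) : translationCost X Y x ≤ Y.size y :=
  Nat.sInf_le ⟨y, h, rfl⟩

theorem exists_size_eq_translationCost {V : Type u} {X : Model.{u, w₁} V} {Y : Model.{u, w₂} V}
    {x : X.Obj} (h : ∃ y, Y.lang y = X.lang x) :
    ∃ y, Y.lang y = X.lang x ∧ Y.size y = translationCost X Y x :=
  Nat.sInf_mem (Set.Nonempty.image Y.size (s := {y | Y.lang y = X.lang x}) h)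

/-- A translation and a lower bound on infinitely many sizes, with different functions, can be
merged into one tight function: the maximum of the lower bound and of the worst case. -/
theorem exists_tight_function {V : Type u} {X : Model.{u, w₁} V} {Y : Model.{u, w₂} V}
    {U g : ℕ → ℝ} (hU : SizeTranslation X Y U) (hg : SizeLowerBound X Y g)
    (hU0 : ∀ n, 0 ≤ U n) :
    ∃ C > 0, ∃ f : ℕ → ℝ, (∀ n, g n ≤ f n) ∧ (∀ n, f n ≤ max (g n) (C * U n)) ∧
      SizeTranslation X Y f ∧ SizeLowerBound X Y f := by
  obtain ⟨C, hC, hU⟩ := hU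
  obtain ⟨c, hc, F, hF, hlow⟩ := hg
  have hcost : ∀ x, X.Admissible x → (translationCost X Y x : ℝ) ≤ C * U (X.size x) := by
    intro x hx
    obtain ⟨y, hy, hys⟩ := hU x hx
    exact le_trans (by exact_mod_cast translationCost_le hy) hys
  have hbdd : ∀ n, BddAbove (translationCost X Y '' {x | X.Admissible x ∧ X.size x = n}) := by
    rintro n
    refine ⟨⌊C * U n⌋₊, ?_⟩
    rintro _ ⟨x, ⟨hx, rfl⟩, rfl⟩
    exact Nat.le_floor (hcost x hx)
  have hle : ∀ x, X.Admissible x → translationCost X Y x ≤ worstCost X Y (X.size x) :=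
    fun x hx => le_csSup (hbdd _) ⟨x, ⟨hx, rfl⟩, rfl⟩
  have hmem : ∀ x, X.Admissible x → ∃ x', X.Admissible x' ∧ X.size x' = X.size x ∧
      translationCost X Y x' = worstCost X Y (X.size x) := by
    intro x hx
    obtain ⟨x', ⟨hx', hs⟩, he⟩ := Nat.sSup_mem (s := translationCost X Y ''
      {x' | X.Admissible x' ∧ X.size x' = X.size x}) ⟨_, x, ⟨hx, rfl⟩, rfl⟩ (hbdd _)
    exact ⟨x', hx', hs, he⟩
  refine ⟨C, hC, fun n => max (g n) (worstCost X Y n), fun n => le_max_left _ _, fun n => ?_,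
    ?_, ?_⟩
  · refine max_le_max le_rfl ?_
    by_cases hn : ∃ x, X.Admissible x ∧ X.size x = n
    · obtain ⟨x, hx, rfl⟩ := hn
      obtain ⟨x', hx', hs, he⟩ := hmem x hx
      rw [← he, ← hs]
      exact hcost x' hx'
    · have : {x | X.Admissible x ∧ X.size x = n} = ∅ :=
        Set.eq_empty_of_forall_notMem fun x hx => hn ⟨x, hx⟩
      have h0 : worstCost X Y n = 0 := by
        rw [worstCost, this]
        simp
      rw [h0]
      simpa using mul_nonneg hC.le (hU0 n)
  · refine ⟨1, one_pos, fun x hx => ?_⟩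
    obtain ⟨y, hy, -⟩ := hU x hx
    obtain ⟨y, hy, hys⟩ := exists_size_eq_translationCost ⟨y, hy⟩
    refine ⟨y, hy, ?_⟩
    rw [hys, one_mul]
    exact le_trans (by exact_mod_cast hle x hx) (le_max_right _ _)
  -- The lower bound holds at the most expensive object of each size that occurs in the family.
  · refine ⟨min c 1, by positivity, {x | X.Admissible x ∧ X.size x ∈ X.size '' F ∧
      translationCost X Y x = worstCost X Y (X.size x)}, hF.mono ?_, ?_⟩
    · rintro _ ⟨x, hx, rfl⟩
      obtain ⟨x', hx', hs, he⟩ := hmem x (hlow x hx).1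
      exact ⟨x', ⟨hx', ⟨x, hx, hs.symm⟩, by rw [he, hs]⟩, hs⟩
    · rintro x ⟨hx, ⟨z, hz, hzs⟩, he⟩
      refine ⟨hx, fun y hy => ?_⟩
      have h1 : (worstCost X Y (X.size x) : ℝ) ≤ Y.size y := by
        rw [← he]
        exact_mod_cast translationCost_le hy
      have h2 : c * g (X.size x) ≤ worstCost X Y (X.size x) := by
        obtain ⟨hza, hzl⟩ := hlow z hz
        obtain ⟨y', hy', -⟩ := hU z hza
        obtain ⟨y', hy', hys'⟩ := exists_size_eq_translationCost ⟨y', hy'⟩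
        rw [← hzs]
        calc c * g (X.size z) ≤ Y.size y' := hzl y' hy'
          _ = translationCost X Y z := by rw [hys']
          _ ≤ worstCost X Y (X.size z) := by exact_mod_cast hle z hza
      have hw : (0 : ℝ) ≤ worstCost X Y (X.size x) := Nat.cast_nonneg _
      refine le_trans ?_ h1
      dsimp only
      rcases le_total (g (X.size x)) (worstCost X Y (X.size x)) with h | h
      · rw [max_eq_right h]
        exact mul_le_of_le_one_left hw (min_le_right _ _)
      · rw [max_eq_left h]
        exact le_trans (mul_le_mul_of_nonneg_right (min_le_left _ _) (hw.trans h)) h2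

/-- A lower bound from a family indexed by `k` whose equivalent objects have size at least `2 ^ k`.
The sizes in the family are unbounded because translations cost at most `O(4 ^ n)`. -/
theorem sizeLowerBound_of_family {V : Type u} {X : Model.{u, w₁} V} {Y : Model.{u, w₂} V}
    (hU : SizeTranslation X Y (fun n => (4 : ℝ) ^ n)) {g : ℕ → ℝ} {C : ℝ} (hC : 0 < C) (k₀ : ℕ)
    (h : ∀ k ≥ k₀, ∃ x : X.Obj, X.Admissible x ∧ g (X.size x) ≤ C * 2 ^ k ∧
      ∀ y : Y.Obj, Y.lang y = X.lang x → 2 ^ k ≤ Y.size y) :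
    SizeLowerBound X Y g := by
  have : Nonempty X.Obj := ⟨(h k₀ le_rfl).choose⟩
  choose! x hx hg hy using h
  refine ⟨C⁻¹, by positivity, x '' Set.Ici k₀, ?_, ?_⟩
  · intro hfin
    obtain ⟨N, hN⟩ := hfin.bddAbove
    obtain ⟨B, hB, hU⟩ := hU
    obtain ⟨k, hk⟩ := pow_unbounded_of_one_lt (B * 4 ^ N) (one_lt_two : (1 : ℝ) < 2)
    have hmax : k₀ ≤ max k k₀ := le_max_right _ _
    obtain ⟨y, hyl, hys⟩ := hU _ (hx _ hmax)
    have h1 : (2 : ℝ) ^ max k k₀ ≤ Y.size y := by exact_mod_cast hy _ hmax y hyl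
    have h2 : X.size (x (max k k₀)) ≤ N := hN ⟨_, ⟨_, hmax, rfl⟩, rfl⟩
    have h3 : (2 : ℝ) ^ k ≤ 2 ^ max k k₀ := pow_le_pow_right₀ (by norm_num) (le_max_left _ _)
    have h4 : B * (4 : ℝ) ^ X.size (x (max k k₀)) ≤ B * 4 ^ N := by
      gcongr
      norm_num
    linarith
  · rintro _ ⟨k, hk, rfl⟩
    refine ⟨hx k hk, fun y hyl => ?_⟩
    rw [inv_mul_le_iff₀ hC]
    refine (hg k hk).trans ?_
    gcongr
    exact_mod_cast hy k hk y hyl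

theorem const_mul_four_pow_le_eventually (C : ℝ) :
    ∀ᶠ n : ℕ in atTop, C * (4 : ℝ) ^ n ≤ 2 ^ (3 * n) := by
  filter_upwards [(tendsto_pow_atTop_atTop_of_one_lt (one_lt_two : (1 : ℝ) < 2)).eventually_ge_atTop
    C] with n hn
  calc C * (4 : ℝ) ^ n ≤ 2 ^ n * 4 ^ n := by gcongr
    _ = 2 ^ (3 * n) := by rw [← mul_pow, pow_mul]; norm_num

theorem hasTightTranslation_linExp {V : Type u} {X : Model.{u, w₁} V} {Y : Model.{u, w₂} V}
    (hU : SizeTranslation X Y (fun n => (4 : ℝ) ^ n)) (A : ℕ)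
    (h : ∀ k : ℕ, ∃ x : X.Obj, X.Admissible x ∧ X.size x ≤ A * (k + 1) ∧
      ∀ y : Y.Obj, Y.lang y = X.lang x → 2 ^ k ≤ Y.size y) :
    HasTightTranslation linExp X Y := by
  have hlow : SizeLowerBound X Y (fun n => (2 : ℝ) ^ (((A : ℝ) + 1)⁻¹ * n)) := by
    refine sizeLowerBound_of_family hU (C := 2) (by norm_num) 0 fun k _ => ?_
    obtain ⟨x, hx, hs, hy⟩ := h k
    refine ⟨x, hx, ?_, hy⟩
    rw [← pow_succ', ← Real.rpow_natCast]
    refine Real.rpow_le_rpow_of_exponent_le (by norm_num) ?_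
    rw [inv_mul_le_iff₀ (by positivity)]
    have : X.size x ≤ (A + 1) * (k + 1) := by linarith
    exact_mod_cast this
  obtain ⟨C, -, f, hgf, hfU, h1, h2⟩ := exists_tight_function hU hlow fun n => by positivity
  refine ⟨f, ⟨((A : ℝ) + 1)⁻¹, 3, by positivity, ?_⟩, h1, h2⟩
  filter_upwards [const_mul_four_pow_le_eventually C] with n hn
  refine ⟨hgf n, (hfU n).trans (max_le ?_ ?_)⟩
  · refine Real.rpow_le_rpow_of_exponent_le (by norm_num) ?_
    gcongr
    have : ((A : ℝ) + 1)⁻¹ ≤ 1 := inv_le_one_of_one_le₀ (by simp)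
    linarith
  · refine hn.trans_eq ?_
    rw [← Real.rpow_natCast]
    push_cast
    rfl

theorem hasTightTranslation_polyExp {V : Type u} {X : Model.{u, w₁} V} {Y : Model.{u, w₂} V}
    (hU : SizeTranslation X Y (fun n => (4 : ℝ) ^ n)) (A d : ℕ)
    (h : ∀ k : ℕ, ∃ x : X.Obj, X.Admissible x ∧ X.size x ≤ A * (k + 1) ^ d ∧
      ∀ y : Y.Obj, Y.lang y = X.lang x → 2 ^ k ≤ Y.size y) :
    HasTightTranslation polyExp X Y := by
  set c : ℝ := (d + 1 : ℝ)⁻¹ with hc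
  have hc0 : 0 < c := by positivity
  have hc1 : c ≤ 1 := inv_le_one_of_one_le₀ (by simp)
  have hlow : SizeLowerBound X Y (fun n => (2 : ℝ) ^ ((n : ℝ) ^ c)) := by
    refine sizeLowerBound_of_family hU (C := 2) (by norm_num) A fun k hk => ?_
    obtain ⟨x, hx, hs, hy⟩ := h k
    refine ⟨x, hx, ?_, hy⟩
    -- The constant factor `A` of the size is absorbed by one more factor `k + 1`.
    have hs' : X.size x ≤ (k + 1) ^ (d + 1) := by
      refine hs.trans ?_
      rw [pow_succ']
      exact Nat.mul_le_mul_right _ (hk.trans (Nat.le_succ k))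
    rw [← pow_succ', ← Real.rpow_natCast]
    refine Real.rpow_le_rpow_of_exponent_le (by norm_num) ?_
    calc (X.size x : ℝ) ^ c ≤ (((k + 1 : ℕ) : ℝ) ^ (d + 1)) ^ c := by
          gcongr
          exact_mod_cast hs'
      _ = ((k + 1 : ℕ) : ℝ) := by
          rw [hc, ← Nat.cast_succ]
          exact Real.pow_rpow_inv_natCast (Nat.cast_nonneg _) (Nat.succ_ne_zero d)
  obtain ⟨C, -, f, hgf, hfU, h1, h2⟩ := exists_tight_function hU hlow fun n => by positivity
  refine ⟨f, ⟨c, 2, hc0, ?_⟩, h1, h2⟩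
  filter_upwards [const_mul_four_pow_le_eventually C, eventually_ge_atTop 3] with n hn hn3
  have hn3' : (3 : ℝ) ≤ n := by exact_mod_cast hn3
  refine ⟨hgf n, (hfU n).trans (max_le ?_ ?_)⟩
  · refine Real.rpow_le_rpow_of_exponent_le (by norm_num) ?_
    exact Real.rpow_le_rpow_of_exponent_le (by linarith) (by linarith)
  · refine hn.trans ?_
    rw [← Real.rpow_natCast]
    refine Real.rpow_le_rpow_of_exponent_le (by norm_num) ?_
    push_cast
    rw [Real.rpow_two, sq]
    gcongr

/-! ### Derivation trees and derivations -/

theorem DerivForest.exists_split {V : Type u} {G : ContextFreeGrammar V}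
    {s t : List (Symbol V G.NT)} (h : DerivForest G (s ++ t)) :
    ∃ (f : DerivForest G s) (g : DerivForest G t), h.yield = f.yield ++ g.yield := by
  induction s with
  | nil => exact ⟨.nil, h, rfl⟩
  | cons x s ih =>
    change DerivForest G (x :: (s ++ t)) at h
    cases h with
    | terminal a rest =>
      obtain ⟨f, g, hfg⟩ := ih rest
      exact ⟨.terminal a f, g, by simp [DerivForest.yield, hfg]⟩
    | nonterminal A α hr children rest =>
      obtain ⟨f, g, hfg⟩ := ih rest
      exact ⟨.nonterminal A α hr children f, g, by simp [DerivForest.yield, hfg]⟩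

theorem DerivForest.exists_of_rewrites {V : Type u} {G : ContextFreeGrammar V}
    {r : ContextFreeRule V G.NT} (hr : r ∈ G.rules) {s t : List (Symbol V G.NT)}
    (h : r.Rewrites s t) (f : DerivForest G t) : ∃ g : DerivForest G s, g.yield = f.yield := by
  induction h with
  | head s =>
    obtain ⟨f₁, f₂, hf⟩ := f.exists_split
    exact ⟨.nonterminal r.input r.output hr f₁ f₂, hf.symm⟩
  | cons x _ ih =>
    cases f with
    | terminal a rest =>
      obtain ⟨g, hg⟩ := ih rest
      exact ⟨.terminal a g, by simp [DerivForest.yield, hg]⟩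
    | nonterminal A α hr children rest =>
      obtain ⟨g, hg⟩ := ih rest
      exact ⟨.nonterminal A α hr children g, by simp [DerivForest.yield, hg]⟩

theorem DerivForest.exists_of_word {V : Type u} (G : ContextFreeGrammar V) (a : List V) :
    ∃ f : DerivForest G (a.map Symbol.terminal), f.yield = a := by
  induction a with
  | nil => exact ⟨.nil, rfl⟩
  | cons v a ih =>
    obtain ⟨f, hf⟩ := ih
    exact ⟨.terminal v f, by simp [DerivForest.yield, hf]⟩

theorem DerivForest.derives {V : Type u} {G : ContextFreeGrammar V} {s : List (Symbol V G.NT)}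
    (f : DerivForest G s) : G.Derives s (f.yield.map Symbol.terminal) := by
  induction f with
  | nil => exact .refl []
  | terminal a rest ih => exact ih.append_left [Symbol.terminal a]
  | @nonterminal A α h s children rest ihc ihr =>
    rw [DerivForest.yield, List.map_append]
    have h1 : G.Produces (Symbol.nonterminal A :: s) (α ++ s) :=
      ⟨_, h, ContextFreeRule.Rewrites.head s⟩
    exact h1.trans_derives ((ihc.append_right s).trans (ihr.append_left _))

theorem mem_language_iff_exists_tree {V : Type u} (G : ContextFreeGrammar V) (a : List V) :
    a ∈ G.language ↔ ∃ t : DerivTree G, t.yield = a := by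
  constructor
  · intro h
    rw [ContextFreeGrammar.mem_language_iff] at h
    change ∃ t : DerivForest G [Symbol.nonterminal G.initial], t.yield = a
    generalize [Symbol.nonterminal G.initial] = s at h ⊢
    induction h using Relation.ReflTransGen.head_induction_on with
    | refl => exact DerivForest.exists_of_word G a
    | head h _ ih =>
      obtain ⟨r, hr, hrw⟩ := h
      obtain ⟨f, hf⟩ := ih
      obtain ⟨g, hg⟩ := DerivForest.exists_of_rewrites hr hrw f
      exact ⟨g, hg.trans hf⟩
  · rintro ⟨t, rfl⟩
    exact t.derives

theorem cfgUnambiguous_of_injective {V : Type u} {G : ContextFreeGrammar V}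
    (h : ∀ t t' : DerivTree G, t.yield = t'.yield → t = t') : CFGUnambiguous G := by
  intro a ha
  obtain ⟨t, ht⟩ := (mem_language_iff_exists_tree G a).1 ha
  exact ⟨t, ht, fun t' ht' => h _ _ (ht'.trans ht.symm)⟩

theorem DerivForest.eq_nil {V : Type u} {G : ContextFreeGrammar V} (f : DerivForest G []) :
    f = .nil := by
  cases f
  rfl

theorem DerivForest.exists_rule {V : Type u} {G : ContextFreeGrammar V} {A : G.NT}
    (t : DerivForest G [Symbol.nonterminal A]) :
    ∃ (α : List (Symbol V G.NT)) (h : ContextFreeRule.mk A α ∈ G.rules) (f : DerivForest G α),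
      t = .nonterminal A α h f .nil := by
  cases t with
  | nonterminal A α h children rest =>
    cases rest
    exact ⟨α, h, children, rfl⟩

theorem DerivForest.exists_rule_of_sandwich {V : Type u} {G : ContextFreeGrammar V} {A : G.NT}
    {v w : V} (f : DerivForest G [.terminal v, .nonterminal A, .terminal w]) :
    ∃ (α : List (Symbol V G.NT)) (h : ContextFreeRule.mk A α ∈ G.rules) (g : DerivForest G α),
      f = .terminal v (.nonterminal A α h g (.terminal w .nil)) := by
  cases f with
  | terminal _ f =>
    cases f with
    | nonterminal _ α h g f =>
      cases f with
      | terminal _ f =>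
        cases f
        exact ⟨α, h, g, rfl⟩

/-! ### The size of a grammar -/

theorem length_le_concatSize {S : Type*} (α : List S) : α.length ≤ concatSize α := by
  unfold concatSize
  omega

theorem concatSize_le {S : Type*} (α : List S) : concatSize α ≤ 2 * α.length + 1 := by
  unfold concatSize
  omega

theorem cfgSize_le {V : Type u} (G : ContextFreeGrammar V) :
    cfgSize G ≤ ∑ r ∈ G.rules, (2 * r.output.length + 2) := by
  unfold cfgSize
  calc _ ≤ ∑ r ∈ G.rules, concatSize r.output + G.rules.card := by gcongr; exact Nat.sub_le _ _
    _ = ∑ r ∈ G.rules, (concatSize r.output + 1) := by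
        rw [Finset.sum_add_distrib, Finset.card_eq_sum_ones]
    _ ≤ _ := Finset.sum_le_sum fun r _ => Nat.succ_le_succ (concatSize_le r.output)

theorem DerivForest.mem_of_mem_yield {V : Type u} {G : ContextFreeGrammar V}
    {s : List (Symbol V G.NT)} (f : DerivForest G s) {v : V} (hv : v ∈ f.yield) :
    Symbol.terminal v ∈ s ∨ ∃ r ∈ G.rules, Symbol.terminal v ∈ r.output := by
  induction f with
  | nil => simp [DerivForest.yield] at hv
  | terminal a rest ih =>
    rcases List.mem_cons.1 hv with rfl | hv
    · exact Or.inl List.mem_cons_self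
    · exact (ih hv).imp_left (List.mem_cons_of_mem _)
  | nonterminal A α h children rest ihc ihr =>
    rcases List.mem_append.1 hv with hv | hv
    · exact Or.inr ((ihc hv).elim (fun h' => ⟨_, h, h'⟩) id)
    · exact (ihr hv).imp_left (List.mem_cons_of_mem _)

theorem CFG_alphabetBounded (V : Type u) : (CFG V).AlphabetBounded := by
  classical
  intro G
  change ContextFreeGrammar V at G
  refine ⟨G.rules.biUnion fun r => (r.output.filterMap fun s =>
    match s with
    | .terminal v => some v
    | .nonterminal _ => none).toFinset, ?_, ?_⟩
  · calc _ ≤ ∑ r ∈ G.rules, _ := Finset.card_biUnion_le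
      _ ≤ ∑ r ∈ G.rules, concatSize r.output := Finset.sum_le_sum fun r _ =>
          (List.toFinset_card_le _).trans
            ((List.length_filterMap_le _ _).trans (length_le_concatSize _))
      _ ≤ cfgSize G := Nat.le_add_right _ _
  · intro a ha v hv
    obtain ⟨t, rfl⟩ := (mem_language_iff_exists_tree G a).1 ha
    obtain h | ⟨r, hr, h⟩ := t.mem_of_mem_yield hv
    · simp at h
    · simp only [Finset.mem_biUnion, List.mem_toFinset, List.mem_filterMap]
      exact ⟨r, hr, _, h, rfl⟩

theorem UCFG_alphabetBounded (V : Type u) : (UCFG V).AlphabetBounded :=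
  fun G => CFG_alphabetBounded V G.1

/-! ### Grammars for finite sets of words -/

theorem DerivForest.eq_of_terminals {V : Type u} {G : ContextFreeGrammar V} {a : List V}
    (f g : DerivForest G (a.map Symbol.terminal)) : f = g := by
  induction a with
  | nil => cases f; cases g; rfl
  | cons v a ih =>
    cases f with
    | terminal _ rest =>
      cases g with
      | terminal _ rest' => rw [ih rest rest']

theorem DerivForest.yield_of_terminals {V : Type u} {G : ContextFreeGrammar V} {a : List V}
    (f : DerivForest G (a.map Symbol.terminal)) : f.yield = a := by
  obtain ⟨g, hg⟩ := DerivForest.exists_of_word G a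
  rw [f.eq_of_terminals g, hg]

open Classical in
/-- The grammar whose only nonterminal derives each word of `S` in one step. -/
noncomputable def listGrammar {V : Type u} (S : Finset (List V)) : ContextFreeGrammar V where
  NT := Unit
  initial := ()
  rules := S.image fun a => ⟨(), a.map Symbol.terminal⟩

theorem mem_listGrammar_rules {V : Type u} {S : Finset (List V)} {r : ContextFreeRule V Unit} :
    r ∈ (listGrammar S).rules ↔
      ∃ a ∈ S, (⟨(), a.map Symbol.terminal⟩ : ContextFreeRule V Unit) = r := by
  classical
  exact Finset.mem_image

theorem listGrammar_tree {V : Type u} {S : Finset (List V)} (t : DerivTree (listGrammar S)) :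
    ∃ a ∈ S, ∃ (h : ContextFreeRule.mk () (a.map Symbol.terminal) ∈ (listGrammar S).rules)
      (f : DerivForest (listGrammar S) (a.map Symbol.terminal)),
      t = .nonterminal () _ h f .nil := by
  cases t with
  | nonterminal A α h children rest =>
    cases rest
    obtain ⟨a, ha, he⟩ := mem_listGrammar_rules.1 h
    cases he
    exact ⟨a, ha, h, children, rfl⟩

theorem UCFG_expressive (V : Type u) : (UCFG V).Expressive := by
  classical
  refine ⟨2, fun S => ⟨⟨listGrammar S, cfgUnambiguous_of_injective ?_⟩, fun a => ?_, ?_⟩⟩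
  · intro t t' htt
    obtain ⟨a, -, h, f, rfl⟩ := listGrammar_tree t
    obtain ⟨b, -, h', f', rfl⟩ := listGrammar_tree t'
    simp only [DerivForest.yield, List.append_nil, f.yield_of_terminals,
      f'.yield_of_terminals] at htt
    subst htt
    rw [f.eq_of_terminals f']
  · refine (mem_language_iff_exists_tree _ a).trans ⟨?_, fun ha => ?_⟩
    · rintro ⟨t, rfl⟩
      obtain ⟨a, ha, h, f, rfl⟩ := listGrammar_tree t
      simpa [DerivForest.yield, f.yield_of_terminals] using ha
    · obtain ⟨f, hf⟩ := DerivForest.exists_of_word (listGrammar S) a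
      exact ⟨.nonterminal () _ (mem_listGrammar_rules.2 ⟨a, ha, rfl⟩) f .nil,
        by simp [DerivForest.yield, hf]⟩
  · refine (cfgSize_le _).trans ?_
    have hinj : Set.InjOn (fun a : List V =>
        (⟨(), a.map Symbol.terminal⟩ : ContextFreeRule V Unit)) S := by
      intro a _ b _ hab
      have h := congrArg ContextFreeRule.output hab
      exact List.map_injective_iff.2 (fun x y h => Symbol.terminal.inj h) h
    have : ∑ r ∈ (listGrammar S).rules, (2 * r.output.length + 2) =
        ∑ a ∈ S, (2 * a.length + 2) := by
      refine (Finset.sum_image hinj).trans (Finset.sum_congr rfl fun a _ => ?_)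
      exact congrArg (2 * · + 2) (List.length_map _)
    rw [this, mul_add, Finset.mul_sum]
    simp [mul_add]

/-! ### Palindromes -/

/-- An injective family of symbols, indexed by pairs of numbers. -/
noncomputable def sym (V : Type u) [Infinite V] (p c : ℕ) : V :=
  Infinite.natEmbedding V (Nat.pair p c)

theorem sym_inj {V : Type u} [Infinite V] {p c p' c' : ℕ} :
    sym V p c = sym V p' c' ↔ p = p' ∧ c = c' := by
  simp [sym, Nat.pair_eq_pair]

/-- The first index of a symbol `sym V p c`. -/
noncomputable def symPos {V : Type u} [Infinite V] (v : V) : ℕ :=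
  (Nat.unpair (Function.invFun (Infinite.natEmbedding V) v)).1

@[simp]
theorem symPos_sym {V : Type u} [Infinite V] (p c : ℕ) : symPos (sym V p c) = p := by
  simp [symPos, sym, Function.leftInverse_invFun (Infinite.natEmbedding V).injective _]

/-- The left half of the palindrome of length `2 * k` with inner half-word `x`: a suffix of length
`j` of the half-word occupies the positions `k - j, …, k - 1`. -/
noncomputable def palLeft (V : Type u) [Infinite V] (k : ℕ) : List (Fin 2) → List V
  | [] => []
  | b :: x => sym V (k - (x.length + 1)) b :: palLeft V k x

/-- The right half of the palindrome of length `2 * k`, mirroring `palLeft`. -/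
noncomputable def palRight (V : Type u) [Infinite V] (k : ℕ) : List (Fin 2) → List V
  | [] => []
  | b :: x => palRight V k x ++ [sym V (k + x.length) b]

@[simp]
theorem length_palLeft {V : Type u} [Infinite V] (k : ℕ) (x : List (Fin 2)) :
    (palLeft V k x).length = x.length := by
  induction x with
  | nil => rfl
  | cons b x ih => simp [palLeft, ih]

@[simp]
theorem length_palRight {V : Type u} [Infinite V] (k : ℕ) (x : List (Fin 2)) :
    (palRight V k x).length = x.length := by
  induction x with
  | nil => rfl
  | cons b x ih => simp [palRight, ih]

theorem palLeft_injective (V : Type u) [Infinite V] (k : ℕ) :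
    Function.Injective (palLeft V k) := by
  intro x
  induction x with
  | nil =>
    rintro (_ | ⟨c, y⟩) h
    · rfl
    · simp [palLeft] at h
  | cons b x ih =>
    rintro (_ | ⟨c, y⟩) h
    · simp [palLeft] at h
    · simp only [palLeft, List.cons.injEq, sym_inj, Fin.val_inj] at h
      rw [h.1.2, ih h.2]

theorem palRight_injective (V : Type u) [Infinite V] (k : ℕ) :
    Function.Injective (palRight V k) := by
  intro x
  induction x with
  | nil =>
    rintro (_ | ⟨c, y⟩) h
    · rfl
    · simp [palRight] at h
  | cons b x ih =>
    rintro (_ | ⟨c, y⟩) h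
    · simp [palRight] at h
    · have h := List.append_inj' h rfl
      simp only [List.cons.injEq, sym_inj, Fin.val_inj] at h
      rw [h.2.1.2, ih h.1]

theorem map_symPos_pal {V : Type u} [Infinite V] (k : ℕ) (x : List (Fin 2)) (hx : x.length ≤ k) :
    (palLeft V k x ++ palRight V k x).map symPos = List.range' (k - x.length) (2 * x.length) := by
  induction x with
  | nil => rfl
  | cons b x ih =>
    simp only [List.length_cons] at hx
    have hih := ih (by omega)
    rw [palLeft, palRight, List.cons_append, ← List.append_assoc, List.map_cons, List.map_append,
      hih, List.length_cons, show 2 * (x.length + 1) = 2 * x.length + 1 + 1 by ring,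
      List.range'_succ, List.range'_concat]
    simp only [symPos_sym, List.map_cons, List.map_nil, one_mul]
    rw [show k - (x.length + 1) + 1 = k - x.length by omega,
      show k - x.length + 2 * x.length = k + x.length by omega]

/-- The right-hand side of a rule of `palGrammar` for the nonterminal `j + 1`: it puts symbols with
the same value `b` at the mirror positions `k - (j + 1)` and `k + j`. -/
noncomputable abbrev palRule (V : Type u) [Infinite V] (k j : ℕ) (b : Fin 2) :
    List (Symbol V ℕ) :=
  [.terminal (sym V (k - (j + 1)) b), .nonterminal j, .terminal (sym V (k + j) b)]

open Classical in
/-- A grammar for the palindromes of length `2 * k`, whose nonterminal `j` derives the factors of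
length `2 * j` in the middle. -/
noncomputable abbrev palGrammar (V : Type u) [Infinite V] (k : ℕ) : ContextFreeGrammar V where
  NT := ℕ
  initial := k
  rules := insert ⟨0, []⟩
    ((Finset.range k ×ˢ Finset.univ).image fun p : ℕ × Fin 2 => ⟨p.1 + 1, palRule V k p.1 p.2⟩)

theorem mem_palGrammar_rules {V : Type u} [Infinite V] {k A : ℕ} {α : List (Symbol V ℕ)} :
    (⟨A, α⟩ : ContextFreeRule V ℕ) ∈ (palGrammar V k).rules ↔
      (A = 0 ∧ α = []) ∨ ∃ j < k, ∃ b, A = j + 1 ∧ α = palRule V k j b := by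
  classical
  have h : (⟨A, α⟩ : ContextFreeRule V ℕ) ∈ (palGrammar V k).rules ↔ _ := Finset.mem_insert
  rw [h]
  simp only [ContextFreeRule.mk.injEq, Finset.mem_image,
    Finset.mem_product, Finset.mem_range, Finset.mem_univ, and_true, Prod.exists]
  refine or_congr Iff.rfl ⟨?_, ?_⟩
  · rintro ⟨j, b, hj, rfl, rfl⟩
    exact ⟨j, hj, b, rfl, rfl⟩
  · rintro ⟨j, hj, b, rfl, rfl⟩
    exact ⟨j, b, hj, rfl, rfl⟩

/-- Derivation trees of `palGrammar V k` whose root is the nonterminal `j`. -/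
abbrev PalTree (V : Type u) [Infinite V] (k j : ℕ) : Type u :=
  DerivForest (palGrammar V k) [Symbol.nonterminal j]

theorem PalTree.exists_zero {V : Type u} [Infinite V] {k : ℕ} (t : PalTree V k 0) :
    ∃ h, t = .nonterminal (G := palGrammar V k) (0 : ℕ) [] h .nil .nil := by
  obtain ⟨α, h, f, rfl⟩ := t.exists_rule
  obtain ⟨-, rfl⟩ | ⟨j, -, b, h0, -⟩ := mem_palGrammar_rules.1 h
  · rw [f.eq_nil]
    exact ⟨h, rfl⟩
  · exact absurd h0.symm (Nat.succ_ne_zero j)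

theorem PalTree.exists_succ {V : Type u} [Infinite V] {k j : ℕ} (t : PalTree V k (j + 1)) :
    ∃ (b : Fin 2) (h : _) (α : _) (h' : _) (f : DerivForest (palGrammar V k) α),
      t = .nonterminal (G := palGrammar V k) (j + 1 : ℕ) (palRule V k j b) h
        (.terminal _ (.nonterminal j α h' f (.terminal _ .nil))) .nil := by
  obtain ⟨α, h, f, rfl⟩ := t.exists_rule
  obtain ⟨h0, -⟩ | ⟨i, -, b, hi, rfl⟩ := mem_palGrammar_rules.1 h
  · exact absurd h0 (Nat.succ_ne_zero j)
  · obtain rfl := Nat.succ_injective hi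
    obtain ⟨α, h', g, rfl⟩ := f.exists_rule_of_sandwich
    exact ⟨b, h, α, h', g, rfl⟩

theorem PalTree.exists_word {V : Type u} [Infinite V] {k : ℕ} (j : ℕ) (t : PalTree V k j) :
    ∃ x : List (Fin 2), x.length = j ∧ t.yield = palLeft V k x ++ palRight V k x := by
  induction j with
  | zero =>
    obtain ⟨h, rfl⟩ := PalTree.exists_zero t
    exact ⟨[], rfl, rfl⟩
  | succ j ih =>
    obtain ⟨b, h, α, h', f, rfl⟩ := PalTree.exists_succ t
    obtain ⟨x, rfl, hx⟩ := ih (.nonterminal _ α h' f .nil)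
    refine ⟨b :: x, rfl, ?_⟩
    simp only [DerivForest.yield, List.append_nil] at hx
    simp [DerivForest.yield, hx, palLeft, palRight]

theorem PalTree.yield_injective {V : Type u} [Infinite V] {k : ℕ} (j : ℕ)
    (t t' : PalTree V k j) (h : t.yield = t'.yield) : t = t' := by
  induction j with
  | zero =>
    obtain ⟨h, rfl⟩ := PalTree.exists_zero t
    obtain ⟨h', rfl⟩ := PalTree.exists_zero t'
    rfl
  | succ j ih =>
    obtain ⟨b, h₁, α, h₂, f, rfl⟩ := PalTree.exists_succ t
    obtain ⟨b', h₁', α', h₂', f', rfl⟩ := PalTree.exists_succ t'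
    simp only [DerivForest.yield, List.append_nil, List.cons.injEq, sym_inj, Fin.val_inj,
      true_and] at h
    obtain ⟨rfl, h⟩ := h
    have := ih (.nonterminal _ α h₂ f .nil) (.nonterminal _ α' h₂' f' .nil)
      (by simpa [DerivForest.yield] using h)
    cases this
    rfl

theorem PalTree.exists_yield_eq {V : Type u} [Infinite V] {k : ℕ} (x : List (Fin 2))
    (hx : x.length ≤ k) :
    ∃ t : PalTree V k x.length, t.yield = palLeft V k x ++ palRight V k x := by
  induction x with
  | nil =>
    exact ⟨.nonterminal (G := palGrammar V k) (0 : ℕ) []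
      (mem_palGrammar_rules.2 (Or.inl ⟨rfl, rfl⟩)) .nil .nil, rfl⟩
  | cons b x ih =>
    obtain ⟨t, ht⟩ := ih (Nat.le_of_succ_le hx)
    obtain ⟨α, h, f, rfl⟩ := t.exists_rule
    refine ⟨.nonterminal (G := palGrammar V k) (x.length + 1 : ℕ) (palRule V k x.length b)
      (mem_palGrammar_rules.2 (Or.inr ⟨_, hx, b, rfl, rfl⟩))
      (.terminal _ (.nonterminal _ α h f (.terminal _ .nil))) .nil, ?_⟩
    simp only [DerivForest.yield, List.append_nil] at ht
    simp [DerivForest.yield, ht, palLeft, palRight]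

theorem mem_palGrammar_language {V : Type u} [Infinite V] {k : ℕ} {a : List V} :
    a ∈ (palGrammar V k).language ↔
      ∃ x : List (Fin 2), x.length = k ∧ a = palLeft V k x ++ palRight V k x := by
  rw [mem_language_iff_exists_tree]
  constructor
  · rintro ⟨t, rfl⟩
    exact PalTree.exists_word k t
  · rintro ⟨x, rfl, rfl⟩
    exact PalTree.exists_yield_eq x le_rfl

theorem cfgSize_palGrammar_le (V : Type u) [Infinite V] (k : ℕ) :
    cfgSize (palGrammar V k) ≤ 16 * (k + 1) := by
  classical
  refine (cfgSize_le _).trans ?_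
  have hcard : (palGrammar V k).rules.card ≤ 2 * k + 1 := by
    refine (Finset.card_insert_le _ _).trans (Nat.succ_le_succ (Finset.card_image_le.trans ?_))
    simp [mul_comm]
  have hlen : ∀ r ∈ (palGrammar V k).rules, 2 * r.output.length + 2 ≤ 8 := by
    rintro ⟨A, α⟩ hr
    obtain ⟨-, rfl⟩ | ⟨j, -, b, -, rfl⟩ := mem_palGrammar_rules.1 hr <;> simp
  calc _ ≤ (palGrammar V k).rules.card * 8 := by
        simpa using Finset.sum_le_card_nsmul _ _ _ hlen
    _ ≤ 16 * (k + 1) := by omega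

/-- The unambiguous grammar of the palindromes, as an object of the model `UCFG V`. -/
noncomputable def palUCFG (V : Type u) [Infinite V] (k : ℕ) : (UCFG V).Obj :=
  ⟨palGrammar V k, cfgUnambiguous_of_injective (PalTree.yield_injective k)⟩

theorem palUCFG_admissible (V : Type u) [Infinite V] (k : ℕ) : (UCFG V).Admissible (palUCFG V k) :=
  uniformLength_and_disjointPositions_of_map_eq_range symPos (2 * k) fun a ha => by
    obtain ⟨x, rfl, rfl⟩ := mem_palGrammar_language.1 ha
    rw [map_symPos_pal _ _ le_rfl, Nat.sub_self, List.range_eq_range']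

/-- The halves of the palindromes form a fooling set. -/
theorem eq_of_pal_mem_language {V : Type u} [Infinite V] {k : ℕ} {x y : List (Fin 2)}
    (hx : x.length = k)
    (h : palLeft V k x ++ palRight V k y ∈ (palGrammar V k).language) : x = y := by
  obtain ⟨z, hz, h⟩ := mem_palGrammar_language.1 h
  obtain ⟨h1, h2⟩ := List.append_inj h (by simp [hx, hz])
  rw [palLeft_injective V k h1, palRight_injective V k h2]

/-! ### Basic facts on finite automata -/

theorem card_state_le_size {V : Type u} (A : FinAutomaton V) : Nat.card A.State ≤ A.size :=
  Nat.le_add_right _ _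

theorem append_mem_accepts_iff {V : Type u} {σ : Type} {M : NFA V σ} {a b : List V} :
    a ++ b ∈ M.accepts ↔ ∃ q ∈ M.eval a, b ∈ M.acceptsFrom {q} := by
  rw [NFA.mem_accepts, NFA.evalFrom_append]
  simp only [NFA.mem_evalFrom_iff_exists (S := M.evalFrom M.start a), NFA.eval,
    NFA.mem_acceptsFrom]
  tauto

theorem exists_step_of_mem_accepts {V : Type u} {σ : Type} {M : NFA V σ} {a : List V}
    (ha : a ∈ M.accepts) {v : V} (hv : v ∈ a) : ∃ p q, q ∈ M.step p v := by
  obtain ⟨b, c, rfl⟩ := List.append_of_mem hv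
  obtain ⟨p, -, q, -, hq⟩ := append_mem_accepts_iff.1 ha
  rw [NFA.evalFrom_cons, NFA.mem_evalFrom_iff_exists, NFA.stepSet_singleton] at hq
  obtain ⟨q', hq', -⟩ := hq
  exact ⟨p, q', hq'⟩

theorem NFAs_alphabetBounded (V : Type u) : (NFAs V).AlphabetBounded := by
  classical
  intro A
  change FinAutomaton V at A
  refine ⟨A.finite_transitions.toFinset.image fun t => t.2.1, ?_, fun a ha v hv => ?_⟩
  · refine Finset.card_image_le.trans ?_
    rw [← Set.ncard_eq_toFinset_card _ A.finite_transitions]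
    exact Nat.le_add_left _ _
  · obtain ⟨p, q, h⟩ := exists_step_of_mem_accepts ha hv
    exact Finset.mem_image.2 ⟨(p, v, q), by simpa using h, rfl⟩

theorem UFAs_alphabetBounded (V : Type u) : (UFAs V).AlphabetBounded :=
  fun A => NFAs_alphabetBounded V A.1

theorem DFAs_alphabetBounded (V : Type u) : (DFAs V).AlphabetBounded :=
  fun A => NFAs_alphabetBounded V A.1

/-- Where the transitions are deterministic, a run is determined by its first state. -/
theorem subsingleton_path {V : Type u} {σ : Type} {M : NFA V σ}
    (hM : ∀ q a, (M.step q a).Subsingleton) (p : σ) (a : List V) :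
    Subsingleton ((q : σ) × M.Path p q a) := by
  constructor
  induction a generalizing p with
  | nil =>
    rintro ⟨_, ⟨⟩⟩ ⟨_, ⟨⟩⟩
    rfl
  | cons v a ih =>
    rintro ⟨q, h⟩ ⟨q', h'⟩
    cases h with
    | cons t _ _ _ _ ht h =>
    cases h' with
    | cons t' _ _ _ _ ht' h' =>
    obtain rfl := hM _ _ ht ht'
    cases ih t ⟨q, h⟩ ⟨q', h'⟩
    rfl

theorem unambiguous_of_step_subsingleton {V : Type u} {A : FinAutomaton V}
    (hA : ∀ q a, (A.aut.step q a).Subsingleton)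
    (hstart : ∀ a, ∀ p ∈ A.aut.start, ∀ p' ∈ A.aut.start,
      a ∈ A.aut.acceptsFrom {p} → a ∈ A.aut.acceptsFrom {p'} → p = p') :
    A.Unambiguous := by
  intro a ha
  obtain ⟨p, hp, q, hq, ⟨h⟩⟩ := NFA.accepts_iff_exists_path.1 ha
  refine ⟨⟨p, q, h⟩, ⟨hp, hq⟩, ?_⟩
  rintro ⟨p', q', h'⟩ ⟨hp', hq'⟩
  obtain rfl := hstart a p hp p' hp' ⟨q, hq, NFA.mem_evalFrom_iff_nonempty_path.2 ⟨h⟩⟩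
    ⟨q', hq', NFA.mem_evalFrom_iff_nonempty_path.2 ⟨h'⟩⟩
  have := (subsingleton_path hA p a).elim ⟨q, h⟩ ⟨q', h'⟩
  cases this
  rfl

theorem FinAutomaton.Deterministic.unambiguous {V : Type u} {A : FinAutomaton V}
    (hA : A.Deterministic) : A.Unambiguous := by
  obtain ⟨⟨q₀, hq₀⟩, hstep⟩ := hA
  refine unambiguous_of_step_subsingleton hstep fun a p hp p' hp' _ _ => ?_
  rw [hq₀] at hp hp'
  exact hp.trans hp'.symm

theorem evalFrom_singleton_subsingleton {V : Type u} {σ : Type} {M : NFA V σ}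
    (hM : ∀ q a, (M.step q a).Subsingleton) (p : σ) (a : List V) :
    (M.evalFrom {p} a).Subsingleton := by
  intro q hq q' hq'
  obtain ⟨h⟩ := NFA.mem_evalFrom_iff_nonempty_path.1 hq
  obtain ⟨h'⟩ := NFA.mem_evalFrom_iff_nonempty_path.1 hq'
  exact congrArg Sigma.fst ((subsingleton_path hM p a).elim ⟨q, h⟩ ⟨q', h'⟩)

/-- The state of a path after `n` transitions, or its last state if it is shorter. -/
def pathState {V : Type u} {σ : Type} {M : NFA V σ} {p q : σ} {a : List V} :
    M.Path p q a → ℕ → σ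
  | .nil s, _ => s
  | .cons _ s _ _ _ _ _, 0 => s
  | .cons _ _ _ _ _ _ h, n + 1 => pathState h n

theorem exists_path_append {V : Type u} {σ : Type} {M : NFA V σ} {p q r : σ} {a b : List V}
    (h : M.Path p q a) (h' : M.Path q r b) :
    ∃ h'' : M.Path p r (a ++ b), pathState h'' a.length = q := by
  induction h with
  | nil s => exact ⟨h', by cases h' <;> rfl⟩
  | cons t s u v x ht _ ih =>
    obtain ⟨h'', hq⟩ := ih h'
    exact ⟨.cons t s r v (x ++ b) ht h'', hq⟩

/-- In an unambiguous automaton, a factorization of an accepted word determines the state of an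
accepting run at the cut. -/
theorem FinAutomaton.Unambiguous.state_unique {V : Type u} {A : FinAutomaton V}
    (hA : A.Unambiguous) {a b : List V} {q q' : A.State}
    (hq : q ∈ A.aut.eval a) (hqb : b ∈ A.aut.acceptsFrom {q})
    (hq' : q' ∈ A.aut.eval a) (hqb' : b ∈ A.aut.acceptsFrom {q'}) : q = q' := by
  have key : ∀ q, q ∈ A.aut.eval a → b ∈ A.aut.acceptsFrom {q} →
      ∃ ρ : (p : A.State) × (r : A.State) × A.aut.Path p r (a ++ b),
        (ρ.1 ∈ A.aut.start ∧ ρ.2.1 ∈ A.aut.accept) ∧ pathState ρ.2.2 a.length = q := by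
    intro q hq hqb
    obtain ⟨p, hp, hpq⟩ := NFA.mem_evalFrom_iff_exists.1 hq
    obtain ⟨r, hr, hqr⟩ := hqb
    obtain ⟨h₁⟩ := NFA.mem_evalFrom_iff_nonempty_path.1 hpq
    obtain ⟨h₂⟩ := NFA.mem_evalFrom_iff_nonempty_path.1 hqr
    obtain ⟨h, hh⟩ := exists_path_append h₁ h₂
    exact ⟨⟨p, r, h⟩, ⟨hp, hr⟩, hh⟩
  obtain ⟨ρ, hρ, h⟩ := key q hq hqb
  obtain ⟨ρ', hρ', h'⟩ := key q' hq' hqb'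
  have hab : a ++ b ∈ A.aut.accepts := NFA.accepts_iff_exists_path.2
    ⟨ρ.1, hρ.1, ρ.2.1, hρ.2, ⟨ρ.2.2⟩⟩
  rw [← h, ← h', (hA _ hab).unique hρ hρ']

/-! ### Prefix trees -/

open Classical in
/-- The nodes of the prefix tree of `S`: all prefixes of its words, and the empty word. -/
noncomputable def prefixes {V : Type u} (S : Finset (List V)) : Finset (List V) :=
  insert [] (S.biUnion fun a => a.inits.toFinset)

theorem mem_prefixes {V : Type u} {S : Finset (List V)} {a : List V} :
    a ∈ prefixes S ↔ a = [] ∨ ∃ b ∈ S, a <+: b := by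
  simp [prefixes]

theorem card_prefixes_le {V : Type u} (S : Finset (List V)) :
    (prefixes S).card ≤ ∑ a ∈ S, (a.length + 1) + 1 := by
  classical
  refine (Finset.card_insert_le _ _).trans (Nat.succ_le_succ (Finset.card_biUnion_le.trans ?_))
  exact Finset.sum_le_sum fun a _ => (List.toFinset_card_le _).trans (by simp)

theorem mem_prefixes_of_append {V : Type u} {S : Finset (List V)} {a b : List V}
    (h : a ++ b ∈ prefixes S) : a ∈ prefixes S := by
  rw [mem_prefixes] at h ⊢
  obtain h | ⟨c, hc, h⟩ := h
  · exact Or.inl (List.append_eq_nil_iff.1 h).1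
  · exact Or.inr ⟨c, hc, (List.prefix_append a b).trans h⟩

/-- The transitions of the prefix tree, with its nodes numbered in order to have a type of states in
the lowest universe. -/
noncomputable def trieNFA {V : Type u} (S : Finset (List V)) : NFA V (Fin (prefixes S).card) where
  step p v := {q | ((prefixes S).equivFin.symm q : List V) = (prefixes S).equivFin.symm p ++ [v]}
  start := {p | ((prefixes S).equivFin.symm p : List V) = []}
  accept := {p | ((prefixes S).equivFin.symm p : List V) ∈ S}

theorem injOn_target_trieNFA {V : Type u} (S : Finset (List V)) :
    Set.InjOn (fun t : Fin (prefixes S).card × V × Fin (prefixes S).card => t.2.2)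
      {t | t.2.2 ∈ (trieNFA S).step t.1 t.2.1} := by
  rintro ⟨p, v, q⟩ h ⟨p', v', q'⟩ h' rfl
  have h1 := h.symm.trans h'
  obtain ⟨h2, h3⟩ := List.append_inj' h1 rfl
  obtain rfl := (prefixes S).equivFin.symm.injective (Subtype.ext h2)
  cases h3
  rfl

/-- The deterministic automaton whose states are the nodes of the prefix tree of `S`. -/
noncomputable def trie {V : Type u} (S : Finset (List V)) : FinAutomaton V where
  State := Fin (prefixes S).card
  aut := trieNFA S
  finite_transitions := Set.Finite.of_injOn (Set.mapsTo_univ _ _) (injOn_target_trieNFA S)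
    Set.finite_univ

theorem trie_deterministic {V : Type u} (S : Finset (List V)) : (trie S).Deterministic := by
  refine ⟨⟨(prefixes S).equivFin ⟨[], mem_prefixes.2 (Or.inl rfl)⟩, ?_⟩, fun p v q hq q' hq' => ?_⟩
  · refine Set.ext fun p => ?_
    exact Subtype.ext_iff.symm.trans ((prefixes S).equivFin.symm_apply_eq (y := ⟨[], _⟩))
  · exact (prefixes S).equivFin.symm.injective (Subtype.ext (hq.trans hq'.symm))

theorem mem_eval_trie {V : Type u} (S : Finset (List V)) (a : List V) (p : Fin (prefixes S).card) :
    p ∈ (trieNFA S).eval a ↔ ((prefixes S).equivFin.symm p : List V) = a := by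
  induction a using List.reverseRecOn generalizing p with
  | nil => exact Iff.rfl
  | append_singleton a v ih =>
    rw [NFA.eval_append_singleton, NFA.mem_stepSet]
    constructor
    · rintro ⟨q, hq, hp⟩
      rw [ih] at hq
      rw [← hq]
      exact hp
    · intro hp
      have ha : a ∈ prefixes S := mem_prefixes_of_append (b := [v])
        (hp ▸ ((prefixes S).equivFin.symm p).2)
      refine ⟨(prefixes S).equivFin ⟨a, ha⟩, (ih _).2 (by simp), ?_⟩
      change _ = _
      simpa using hp

theorem mem_accepts_trie {V : Type u} (S : Finset (List V)) (a : List V) :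
    a ∈ (trieNFA S).accepts ↔ a ∈ S := by
  constructor
  · rintro ⟨p, hp, hpa⟩
    rw [mem_eval_trie] at hpa
    rw [← hpa]
    exact hp
  · intro ha
    have ha' : a ∈ prefixes S := mem_prefixes.2 (Or.inr ⟨a, ha, List.prefix_rfl⟩)
    refine ⟨(prefixes S).equivFin ⟨a, ha'⟩, ?_, (mem_eval_trie S a _).2 (by simp)⟩
    change _ ∈ S
    simpa using ha

theorem size_trie_le {V : Type u} (S : Finset (List V)) :
    (trie S).size ≤ 2 * (∑ a ∈ S, (a.length + 1) + 1) := by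
  have h1 : Nat.card (trie S).State = (prefixes S).card := Nat.card_fin _
  have h2 : {t : (trie S).State × V × (trie S).State |
      t.2.2 ∈ (trie S).aut.step t.1 t.2.1}.ncard ≤ (prefixes S).card := by
    refine (injOn_target_trieNFA S).ncard_image.symm.trans_le ?_
    exact (Set.ncard_le_card _).trans_eq (Nat.card_fin _)
  have := card_prefixes_le S
  rw [FinAutomaton.size, h1]
  omega

theorem DFAs_expressive (V : Type u) : (DFAs V).Expressive :=
  ⟨2, fun S => ⟨⟨trie S, trie_deterministic S⟩, mem_accepts_trie S, size_trie_le S⟩⟩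

theorem UFAs_expressive (V : Type u) : (UFAs V).Expressive :=
  ⟨2, fun S => ⟨⟨trie S, (trie_deterministic S).unambiguous⟩, mem_accepts_trie S, size_trie_le S⟩⟩

theorem NFAs_expressive (V : Type u) : (NFAs V).Expressive :=
  ⟨2, fun S => ⟨trie S, mem_accepts_trie S, size_trie_le S⟩⟩

theorem ExplicitSet_expressive (V : Type u) : (ExplicitSet V).Expressive :=
  ⟨1, fun S => ⟨S, fun _ => Iff.rfl, by simp [ExplicitSet]⟩⟩

/-! ### Lower bounds on the number of states -/

/-- Fooling sets bound the number of states of nondeterministic automata. -/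
theorem card_le_of_foolingSet {V : Type u} (A : FinAutomaton V) {ι : Type*}
    (a b : ι → List V) (h₁ : ∀ i, a i ++ b i ∈ A.aut.accepts)
    (h₂ : ∀ i j, a i ++ b j ∈ A.aut.accepts → i = j) : Nat.card ι ≤ Nat.card A.State := by
  have := A.fintypeState
  have h : ∀ i, ∃ q ∈ A.aut.eval (a i), b i ∈ A.aut.acceptsFrom {q} := fun i =>
    append_mem_accepts_iff.1 (h₁ i)
  choose q hq hb using h
  refine Nat.card_le_card_of_injective q fun i j hij => h₂ i j ?_
  exact append_mem_accepts_iff.2 ⟨q i, hq i, hij ▸ hb j⟩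

/-- Words with pairwise different residual languages lead a deterministic automaton to pairwise
different states, except that at most one of them has no run, as the transition function is
partial. -/
theorem card_le_of_residuals {V : Type u} {A : FinAutomaton V} (hA : A.Deterministic) {ι : Type*}
    (a : ι → List V)
    (h : ∀ i j, (∀ b, a i ++ b ∈ A.aut.accepts ↔ a j ++ b ∈ A.aut.accepts) → i = j) :
    Nat.card ι ≤ Nat.card A.State + 1 := by
  classical
  have := A.fintypeState
  obtain ⟨⟨q₀, hq₀⟩, hstep⟩ := hA
  have hsub : ∀ i, (A.aut.eval (a i)).Subsingleton := fun i => by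
    rw [NFA.eval, hq₀]
    exact evalFrom_singleton_subsingleton hstep q₀ (a i)
  -- The state reached by a word, or `none` where the word has no run.
  let f : ι → Option A.State := fun i =>
    if hi : (A.aut.eval (a i)).Nonempty then some hi.some else none
  have hf : ∀ i, A.aut.eval (a i) = {q | f i = some q} := by
    intro i
    ext q
    by_cases hi : (A.aut.eval (a i)).Nonempty
    · simp only [f, dif_pos hi, Option.some.injEq]
      exact ⟨fun hq => hsub i hi.some_mem hq, fun hq => hq ▸ hi.some_mem⟩
    · simp only [f, dif_neg hi, reduceCtorEq]
      exact ⟨fun hq => hi ⟨q, hq⟩, False.elim⟩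
  have hcard : Nat.card (Option A.State) = Nat.card A.State + 1 := by simp
  rw [← hcard]
  refine Nat.card_le_card_of_injective f fun i j hij => h i j fun b => ?_
  rw [append_mem_accepts_iff, append_mem_accepts_iff, hf i, hf j, hij]

/-- Factoring the matrix with entries `0` for `x ⊆ y` and `1` otherwise needs inner dimension at
least `2 ^ k - 1`: together with a row of ones, its rows generate those of the unitriangular matrix
of inclusions. -/
theorem two_pow_le_of_factorization {k : ℕ} {Q : Type*} [Fintype Q]
    (R : Finset (Fin k) → Q → ℚ) (D : Q → Finset (Fin k) → ℚ)
    (h : ∀ x y, ∑ q, R x q * D q y = if x ⊆ y then 0 else 1) :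
    2 ^ k ≤ Fintype.card Q + 1 := by
  let M : Matrix (Option Q) (Finset (Fin k)) ℚ := fun o x => o.elim 1 (R x)
  have hinj : Function.Injective M.mulVecLin := by
    rw [← LinearMap.ker_eq_bot, LinearMap.ker_eq_bot']
    intro a ha
    have ha' : ∀ o, ∑ x, M o x * a x = 0 := fun o => congrFun ha o
    have hnone : ∑ x, a x = 0 := by simpa [M] using ha' none
    have hsome : ∀ q, ∑ x, R x q * a x = 0 := fun q => ha' (some q)
    -- Subtracting the combination of the given rows from that of the row of ones leaves inclusions.
    have hsub : ∀ y : Finset (Fin k), ∑ x with x ⊆ y, a x = 0 := by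
      intro y
      have h0 : ∑ x, (if x ⊆ y then 0 else 1) * a x = 0 := by
        calc ∑ x, (if x ⊆ y then 0 else 1) * a x = ∑ x, ∑ q, D q y * (R x q * a x) := by
              refine Finset.sum_congr rfl fun x _ => ?_
              rw [← h, Finset.sum_mul]
              exact Finset.sum_congr rfl fun q _ => by ring
          _ = ∑ q, D q y * ∑ x, R x q * a x := by
              rw [Finset.sum_comm]
              exact Finset.sum_congr rfl fun q _ => (Finset.mul_sum _ _ _).symm
          _ = 0 := by simp [hsome]
      calc ∑ x with x ⊆ y, a x = ∑ x, a x - ∑ x, (if x ⊆ y then 0 else 1) * a x := by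
            rw [Finset.sum_filter, ← Finset.sum_sub_distrib]
            refine Finset.sum_congr rfl fun x _ => ?_
            split_ifs <;> simp
        _ = 0 := by rw [hnone, h0, sub_zero]
    funext y
    induction y using Finset.strongInduction with
    | H y ih =>
    have hy := hsub y
    rwa [Finset.sum_eq_single_of_mem y (by simp)] at hy
    intro x hx hxy
    exact ih x (Finset.ssubset_iff_subset_ne.2 ⟨(Finset.mem_filter.1 hx).2, hxy⟩)
  have := LinearMap.finrank_le_finrank_of_injective hinj
  simpa using this

/-- If an unambiguous automaton decides intersection of two sets, where the first half of the word
encodes the first set and the second half the second, then it has at least `2 ^ k - 1` states. -/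
theorem two_pow_le_of_unambiguous {V : Type u} {A : FinAutomaton V} (hA : A.Unambiguous) {k : ℕ}
    (a b : Finset (Fin k) → List V)
    (h : ∀ x y, a x ++ b y ∈ A.aut.accepts ↔ ∃ i ∈ x, i ∈ y) : 2 ^ k ≤ Nat.card A.State + 1 := by
  classical
  have := A.fintypeState
  rw [Nat.card_eq_fintype_card]
  -- Complementing the second set turns disjointness into inclusion.
  refine two_pow_le_of_factorization (fun x q => if q ∈ A.aut.eval (a x) then 1 else 0)
    (fun q y => if b yᶜ ∈ A.aut.acceptsFrom {q} then 1 else 0) fun x y => ?_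
  have hxy : x ⊆ y ↔ ¬ ∃ q ∈ A.aut.eval (a x), b yᶜ ∈ A.aut.acceptsFrom {q} := by
    rw [← append_mem_accepts_iff, h]
    simp [Finset.subset_iff]
  split_ifs with hs
  · refine Finset.sum_eq_zero fun q _ => ?_
    rw [hxy] at hs
    by_cases hq : q ∈ A.aut.eval (a x)
    · rw [if_neg fun hb => hs ⟨q, hq, hb⟩, mul_zero]
    · rw [if_neg hq, zero_mul]
  · rw [hxy, not_not] at hs
    obtain ⟨q, hq, hb⟩ := hs
    rw [Finset.sum_eq_single_of_mem q (Finset.mem_univ q), if_pos hq, if_pos hb, one_mul]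
    intro q' _ hne
    by_cases hq' : q' ∈ A.aut.eval (a x)
    · rw [if_neg fun hb' => hne (hA.state_unique hq' hb' hq hb), mul_zero]
    · rw [if_neg hq', zero_mul]

/-! ### Unions of products -/

/-- An automaton for the union over `i < m` of the languages of the words of length `n` whose value
at each position `p` is `sym V p c` with `c ∈ E i p`. It guesses `i` in the initial state, and then
runs through the states `(i, 0), …, (i, n)`. -/
noncomputable def unionNFA (V : Type u) [Infinite V] (m n : ℕ) (E : Fin m → ℕ → Set ℕ) :
    NFA V (Fin m × Fin (n + 1)) where
  step q v := {q' | q'.1 = q.1 ∧ (q'.2 : ℕ) = q.2 + 1 ∧ ∃ c ∈ E q.1 q.2, v = sym V q.2 c}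
  start := {q | (q.2 : ℕ) = 0}
  accept := {q | (q.2 : ℕ) = n}

theorem unionNFA_step_subsingleton {V : Type u} [Infinite V] {m n : ℕ} {E : Fin m → ℕ → Set ℕ}
    (q : Fin m × Fin (n + 1)) (v : V) : ((unionNFA V m n E).step q v).Subsingleton := by
  rintro ⟨i, p⟩ ⟨hi, hp, -⟩ ⟨i', p'⟩ ⟨hi', hp', -⟩
  exact Prod.ext (hi.trans hi'.symm) (Fin.ext (hp.trans hp'.symm))

theorem unionNFA_transitions_subset {V : Type u} [Infinite V] {m n C : ℕ} {E : Fin m → ℕ → Set ℕ}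
    (hE : ∀ i, ∀ p < n, ∀ c ∈ E i p, c < C) :
    {t : (Fin m × Fin (n + 1)) × V × (Fin m × Fin (n + 1)) |
      t.2.2 ∈ (unionNFA V m n E).step t.1 t.2.1} ⊆
    Set.range fun s : Fin m × Fin n × Fin C =>
      ((s.1, s.2.1.castSucc), sym V s.2.1 s.2.2, (s.1, s.2.1.succ)) := by
  rintro ⟨⟨i, p⟩, v, ⟨i', p'⟩⟩ ⟨hi, hp, c, hc, hv⟩
  dsimp only at hi hp hc hv
  subst hi hv
  have hpn : (p : ℕ) < n := by omega
  refine ⟨(i', ⟨p, hpn⟩, ⟨c, hE _ _ hpn _ hc⟩), ?_⟩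
  exact Prod.ext (Prod.ext rfl (Fin.ext rfl))
    (Prod.ext rfl (Prod.ext rfl (Fin.ext hp.symm)))

/-- The automaton `unionNFA`, with all values in the first `n` sets bounded by `C`. -/
noncomputable def unionAutomaton (V : Type u) [Infinite V] (m n C : ℕ) (E : Fin m → ℕ → Set ℕ)
    (hE : ∀ i, ∀ p < n, ∀ c ∈ E i p, c < C) : FinAutomaton V where
  State := Fin m × Fin (n + 1)
  aut := unionNFA V m n E
  finite_transitions := (Set.finite_range _).subset (unionNFA_transitions_subset hE)

theorem size_unionAutomaton_le {V : Type u} [Infinite V] {m n C : ℕ} {E : Fin m → ℕ → Set ℕ}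
    (hE : ∀ i, ∀ p < n, ∀ c ∈ E i p, c < C) :
    (unionAutomaton V m n C E hE).size ≤ m * (n + 1) + m * (n * C) := by
  refine Nat.add_le_add (le_of_eq ?_) ?_
  · exact (Nat.card_prod _ _).trans (by simp)
  · refine (Set.ncard_le_ncard (unionNFA_transitions_subset hE) (Set.finite_range _)).trans ?_
    rw [← Set.image_univ]
    refine (Set.ncard_image_le Set.finite_univ).trans_eq ?_
    simp

theorem mem_evalFrom_unionNFA {V : Type u} [Infinite V] {m n : ℕ} {E : Fin m → ℕ → Set ℕ}
    (i : Fin m) (a : List V) (q : Fin m × Fin (n + 1)) :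
    q ∈ (unionNFA V m n E).evalFrom {(i, 0)} a ↔ q.1 = i ∧ (q.2 : ℕ) = a.length ∧
      ∀ p (hp : p < a.length), ∃ c ∈ E i p, a[p] = sym V p c := by
  induction a using List.reverseRecOn generalizing q with
  | nil =>
    rw [NFA.evalFrom_nil, Set.mem_singleton_iff, Prod.ext_iff, Fin.ext_iff (a := q.2)]
    simp
  | append_singleton a v ih =>
    rw [NFA.evalFrom_append, NFA.evalFrom_singleton, NFA.mem_stepSet]
    constructor
    · rintro ⟨q', hq', h1, h2, c, hc, hv⟩
      obtain ⟨rfl, h3, h4⟩ := (ih q').1 hq'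
      refine ⟨h1, by simp [h2, h3], fun p hp => ?_⟩
      rcases Nat.lt_or_ge p a.length with hpa | hpa
      · rw [List.getElem_append_left hpa]
        exact h4 p hpa
      · have hp' : p = a.length := by simp at hp; omega
        subst hp'
        rw [h3] at hc hv
        exact ⟨c, hc, by simpa using hv⟩
    · rintro ⟨h1, h2, h3⟩
      have h2' : (q.2 : ℕ) = a.length + 1 := by simpa using h2
      obtain ⟨c, hc, hv⟩ := h3 a.length (by simp)
      refine ⟨(i, ⟨a.length, by omega⟩), (ih _).2 ⟨rfl, rfl, fun p hp => ?_⟩, h1, h2', c, hc,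
        by simpa using hv⟩
      obtain ⟨c, hc, hv⟩ := h3 p (by simp; omega)
      exact ⟨c, hc, by rwa [List.getElem_append_left hp] at hv⟩

theorem mem_acceptsFrom_unionNFA {V : Type u} [Infinite V] {m n : ℕ} {E : Fin m → ℕ → Set ℕ}
    (i : Fin m) (a : List V) :
    a ∈ (unionNFA V m n E).acceptsFrom {(i, 0)} ↔ a.length = n ∧
      ∀ p (hp : p < a.length), ∃ c ∈ E i p, a[p] = sym V p c := by
  rw [NFA.mem_acceptsFrom]
  constructor
  · rintro ⟨q, hq, h⟩
    obtain ⟨-, h2, h3⟩ := (mem_evalFrom_unionNFA i a q).1 h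
    exact ⟨h2.symm.trans hq, h3⟩
  · rintro ⟨rfl, h⟩
    exact ⟨(i, Fin.last _), rfl, (mem_evalFrom_unionNFA i a _).2 ⟨rfl, rfl, h⟩⟩

theorem mem_start_unionNFA {V : Type u} [Infinite V] {m n : ℕ} {E : Fin m → ℕ → Set ℕ}
    {q : Fin m × Fin (n + 1)} : q ∈ (unionNFA V m n E).start ↔ ∃ i, q = (i, 0) := by
  constructor
  · intro h
    exact ⟨q.1, Prod.ext rfl (Fin.ext h)⟩
  · rintro ⟨i, rfl⟩
    rfl

theorem mem_accepts_unionNFA {V : Type u} [Infinite V] {m n : ℕ} {E : Fin m → ℕ → Set ℕ}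
    {a : List V} : a ∈ (unionNFA V m n E).accepts ↔ ∃ i, a.length = n ∧
      ∀ p (hp : p < a.length), ∃ c ∈ E i p, a[p] = sym V p c := by
  simp only [← mem_acceptsFrom_unionNFA]
  have : a ∈ (unionNFA V m n E).accepts ↔
      ∃ q ∈ (unionNFA V m n E).start, a ∈ (unionNFA V m n E).acceptsFrom {q} :=
    append_mem_accepts_iff (a := [])
  rw [this]
  constructor
  · rintro ⟨q, hq, h⟩
    obtain ⟨i, rfl⟩ := mem_start_unionNFA.1 hq
    exact ⟨i, h⟩
  · rintro ⟨i, h⟩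
    exact ⟨_, mem_start_unionNFA.2 ⟨i, rfl⟩, h⟩

theorem unionNFA_accepts_admissible {V : Type u} [Infinite V] {m n : ℕ}
    {E : Fin m → ℕ → Set ℕ} : UniformLength (unionNFA V m n E).accepts ∧
      DisjointPositions (unionNFA V m n E).accepts :=
  uniformLength_and_disjointPositions_of_map_eq_range symPos n fun a ha => by
    obtain ⟨i, rfl, h⟩ := mem_accepts_unionNFA.1 ha
    refine List.ext_getElem (by simp) fun p hp hp' => ?_
    obtain ⟨c, -, hc⟩ := h p (by simpa using hp)
    simp [hc]

/-- The factor of a word that occupies the `l` positions from `s` on, with the values given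
by `x`. -/
noncomputable def segment (V : Type u) [Infinite V] (s l : ℕ) (x : ℕ → ℕ) : List V :=
  (List.range' s l).map fun p => sym V p (x p)

theorem segment_append_mem_accepts_unionNFA {V : Type u} [Infinite V] {m k l : ℕ}
    {E : Fin m → ℕ → Set ℕ} {x y : ℕ → ℕ} :
    segment V 0 k x ++ segment V k l y ∈ (unionNFA V m (k + l) E).accepts ↔
      ∃ i, (∀ p < k, x p ∈ E i p) ∧ ∀ p < l, y (k + p) ∈ E i (k + p) := by
  rw [mem_accepts_unionNFA]
  refine exists_congr fun i => ⟨fun h => ⟨fun p hp => ?_, fun p hp => ?_⟩, fun h => ⟨?_, ?_⟩⟩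
  · obtain ⟨c, hc, h⟩ := h.2 p (by simp [segment]; omega)
    rw [List.getElem_append_left (by simpa [segment] using hp)] at h
    simp only [segment, List.getElem_map, List.getElem_range', sym_inj, zero_add, one_mul,
      true_and] at h
    rwa [h]
  · obtain ⟨c, hc, h⟩ := h.2 (k + p) (by simpa [segment] using hp)
    rw [List.getElem_append_right (by simp [segment])] at h
    simp [segment, sym_inj] at h
    rwa [h]
  · simp [segment]
  · intro p hp
    rcases Nat.lt_or_ge p k with hpk | hpk
    · refine ⟨x p, h.1 p hpk, ?_⟩
      rw [List.getElem_append_left (by simpa [segment] using hpk)]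
      simp [segment]
    · obtain ⟨p, rfl⟩ := Nat.exists_eq_add_of_le hpk
      refine ⟨y (k + p), h.2 p (by simpa [segment] using hp), ?_⟩
      rw [List.getElem_append_right (by simp [segment])]
      simp [segment]

/-- The indicator function of a set of numbers below `k`. -/
def bits {k : ℕ} (x : Finset (Fin k)) (p : ℕ) : ℕ :=
  if p ∈ x.map Fin.valEmbedding then 1 else 0

theorem bits_lt_two {k : ℕ} (x : Finset (Fin k)) (p : ℕ) : bits x p < 2 := by
  unfold bits
  split_ifs <;> norm_num

theorem bits_eq_one_iff {k : ℕ} {x : Finset (Fin k)} {i : Fin k} : bits x i = 1 ↔ i ∈ x := by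
  simp [bits, Fin.val_inj]

theorem segment_bits_injective (V : Type u) [Infinite V] (k : ℕ) :
    Function.Injective fun x : Finset (Fin k) => segment V 0 k (bits x) := by
  intro x y h
  ext i
  have h' := List.map_eq_map_iff.1 h i (by simp)
  rw [sym_inj] at h'
  rw [← bits_eq_one_iff, ← bits_eq_one_iff, h'.2]

/-! ### The families of hard languages -/

/-- The sets of values of the automaton for intersecting pairs of subsets of `Fin k`: the bit of the
guessed element is set in both halves. -/
def meetValues (k : ℕ) (i : Fin k) (p : ℕ) : Set ℕ :=
  {c | c < 2 ∧ (p = i ∨ p = k + i → c = 1)}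

/-- The automaton for the pairs of subsets of `Fin k` that intersect. -/
noncomputable def meetAutomaton (V : Type u) [Infinite V] (k : ℕ) : FinAutomaton V :=
  unionAutomaton V k (k + k) 2 (meetValues k) fun _ _ _ _ h => h.1

theorem size_meetAutomaton_le (V : Type u) [Infinite V] (k : ℕ) :
    (meetAutomaton V (k + 1)).size ≤ 24 * (k + 1) ^ 2 := by
  unfold meetAutomaton
  refine (size_unionAutomaton_le _).trans ?_
  nlinarith

theorem mem_accepts_meetAutomaton {V : Type u} [Infinite V] {k : ℕ} {x y : Finset (Fin k)} :
    segment V 0 k (bits x) ++ segment V k k (fun p => bits y (p - k)) ∈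
      (meetAutomaton V k).aut.accepts ↔ ∃ i ∈ x, i ∈ y := by
  refine segment_append_mem_accepts_unionNFA.trans (exists_congr fun i => ?_)
  simp only [← bits_eq_one_iff]
  constructor
  · rintro ⟨h1, h2⟩
    have := (h2 i i.2).2 (Or.inr rfl)
    exact ⟨(h1 i i.2).2 (Or.inl rfl), by simpa using this⟩
  · rintro ⟨h1, h2⟩
    refine ⟨fun p hp => ⟨bits_lt_two _ _, ?_⟩, fun p hp => ⟨bits_lt_two _ _, ?_⟩⟩
    · rintro (rfl | rfl)
      · exact h1
      · omega
    · rintro (h | h)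
      · have := i.2
        omega
      · obtain rfl := Nat.add_left_cancel h
        simpa using h2

/-- The sets of values of the automaton for pairs of a subset of `Fin k` and one of its members:
the last symbol names the guessed element, whose bit is set. -/
def indexValues (k : ℕ) (i : Fin k) (p : ℕ) : Set ℕ :=
  {c | (p < k ∧ c < 2 ∧ (p = i → c = 1)) ∨ (p = k ∧ c = i)}

/-- The automaton for the pairs of a subset of `Fin k` and one of its members. -/
noncomputable def indexAutomaton (V : Type u) [Infinite V] (k : ℕ) : FinAutomaton V :=
  unionAutomaton V k (k + 1) (k + 2) (indexValues k) fun i _ _ c h => by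
    have := i.2
    rcases h with h | h <;> omega

theorem size_indexAutomaton_le (V : Type u) [Infinite V] (k : ℕ) :
    (indexAutomaton V (k + 1)).size ≤ 27 * (k + 1) ^ 3 := by
  unfold indexAutomaton
  refine (size_unionAutomaton_le _).trans ?_
  calc (k + 1) * (k + 1 + 1 + 1) + (k + 1) * ((k + 1 + 1) * (k + 1 + 2))
      ≤ (k + 1) * (3 * (k + 1)) + (k + 1) * (2 * (k + 1) * (3 * (k + 1))) := by
        gcongr <;> omega
    _ ≤ 27 * (k + 1) ^ 3 := by nlinarith [sq_nonneg k]

theorem mem_accepts_indexAutomaton {V : Type u} [Infinite V] {k : ℕ} {x : Finset (Fin k)}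
    {i : Fin k} : segment V 0 k (bits x) ++ segment V k 1 (fun _ => i) ∈
      (indexAutomaton V k).aut.accepts ↔ i ∈ x := by
  refine segment_append_mem_accepts_unionNFA.trans ?_
  rw [← bits_eq_one_iff]
  constructor
  · rintro ⟨j, h1, h2⟩
    have hij : (i : ℕ) = j := by
      rcases h2 0 one_pos with h | h
      · exact absurd h.1 (by simp)
      · exact h.2
    rcases h1 i i.2 with h | h
    · exact h.2.2 hij
    · exact absurd h.1 i.2.ne
  · refine fun h => ⟨i, fun p hp => Or.inl ⟨hp, bits_lt_two _ _, ?_⟩, fun p hp => Or.inr ⟨?_, rfl⟩⟩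
    · rintro rfl
      exact h
    · omega

theorem indexAutomaton_unambiguous (V : Type u) [Infinite V] (k : ℕ) :
    (indexAutomaton V k).Unambiguous := by
  refine unambiguous_of_step_subsingleton unionNFA_step_subsingleton fun a p hp p' hp' h h' => ?_
  obtain ⟨i, rfl⟩ := mem_start_unionNFA.1 hp
  obtain ⟨i', rfl⟩ := mem_start_unionNFA.1 hp'
  obtain ⟨hl, h⟩ := (mem_acceptsFrom_unionNFA i a).1 h
  obtain ⟨-, h'⟩ := (mem_acceptsFrom_unionNFA i' a).1 h'
  -- The last symbol of the word determines the initial state.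
  obtain ⟨c, hc, hv⟩ := h k (by omega)
  obtain ⟨c', hc', hv'⟩ := h' k (by omega)
  have hcc : c = c' := (sym_inj.1 (hv.symm.trans hv')).2
  have h1 : c = i := hc.elim (fun h => absurd h.1 (lt_irrefl k)) And.right
  have h2 : c' = i' := hc'.elim (fun h => absurd h.1 (lt_irrefl k)) And.right
  rw [Fin.ext (h1.symm.trans (hcc.trans h2))]

/-- The deterministic automaton for all bit strings of length `k`. -/
noncomputable def cubeAutomaton (V : Type u) [Infinite V] (k : ℕ) : FinAutomaton V :=
  unionAutomaton V 1 (k + 0) 2 (fun _ _ => {c | c < 2}) fun _ _ _ _ h => h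

theorem size_cubeAutomaton_le (V : Type u) [Infinite V] (k : ℕ) :
    (cubeAutomaton V k).size ≤ 3 * (k + 1) := by
  unfold cubeAutomaton
  refine (size_unionAutomaton_le _).trans ?_
  omega

theorem cubeAutomaton_deterministic (V : Type u) [Infinite V] (k : ℕ) :
    (cubeAutomaton V k).Deterministic := by
  refine ⟨⟨((0 : Fin 1), (0 : Fin (k + 0 + 1))), Set.ext fun q => mem_start_unionNFA.trans ?_⟩,
    unionNFA_step_subsingleton (n := k + 0) (E := fun _ _ => {c | c < 2})⟩
  constructor
  · rintro ⟨i, rfl⟩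
    rw [Subsingleton.elim i 0]
    rfl
  · rintro rfl
    exact ⟨0, rfl⟩

theorem mem_accepts_cubeAutomaton {V : Type u} [Infinite V] {k : ℕ} (x : Finset (Fin k)) :
    segment V 0 k (bits x) ∈ (cubeAutomaton V k).aut.accepts := by
  have : segment V 0 k (bits x) ++ segment V k 0 (bits x) ∈ (cubeAutomaton V k).aut.accepts :=
    segment_append_mem_accepts_unionNFA.2
      ⟨0, fun p _ => bits_lt_two x p, fun p hp => absurd hp (Nat.not_lt_zero p)⟩
  simpa [segment] using this

/-! ### Tight translations -/

theorem card_le_size_explicitSet {V : Type u} {ι : Type*} [Finite ι] {S : (ExplicitSet V).Obj}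
    (a : ι → List V) (ha : Function.Injective a) (h : ∀ i, a i ∈ (ExplicitSet V).lang S) :
    Nat.card ι ≤ (ExplicitSet V).size S := by
  change Finset (List V) at S
  have h1 : Nat.card ι ≤ Nat.card S :=
    Nat.card_le_card_of_injective (fun i => (⟨a i, h i⟩ : S)) fun i j hij =>
      ha (congrArg Subtype.val hij)
  rw [Nat.card_eq_fintype_card (α := S), Fintype.card_coe, Finset.card_eq_sum_ones] at h1
  exact h1.trans (Finset.sum_le_sum fun a _ => Nat.le_add_left _ _)

theorem two_pow_le_size_of_palGrammar {V : Type u} [Infinite V] {k : ℕ} {A : FinAutomaton V}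
    (hA : A.aut.accepts = (palGrammar V k).language) : 2 ^ k ≤ A.size := by
  have h := card_le_of_foolingSet A (ι := List.Vector (Fin 2) k)
    (fun x => palLeft V k x.1) (fun x => palRight V k x.1)
    (fun x => hA ▸ mem_palGrammar_language.2 ⟨x.1, x.2, rfl⟩)
    (fun x y hxy => Subtype.ext (eq_of_pal_mem_language x.2 (hA ▸ hxy)))
  rw [Nat.card_eq_fintype_card, card_vector, Fintype.card_fin] at h
  exact h.trans (card_state_le_size A)

theorem tight_CFG_NFAs (V : Type u) [Infinite V] :
    HasTightTranslation linExp (CFG V) (NFAs V) :=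
  hasTightTranslation_linExp (sizeTranslation_four_pow (CFG_alphabetBounded V) (NFAs_expressive V))
    16 fun k => ⟨palGrammar V k, palUCFG_admissible V k, cfgSize_palGrammar_le V k,
      fun _ hy => two_pow_le_size_of_palGrammar hy⟩

theorem tight_UCFG_UFAs (V : Type u) [Infinite V] :
    HasTightTranslation linExp (UCFG V) (UFAs V) :=
  hasTightTranslation_linExp (sizeTranslation_four_pow (UCFG_alphabetBounded V) (UFAs_expressive V))
    16 fun k => ⟨palUCFG V k, palUCFG_admissible V k, cfgSize_palGrammar_le V k,
      fun _ hy => two_pow_le_size_of_palGrammar hy⟩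

theorem tight_CFG_ExplicitSet (V : Type u) [Infinite V] :
    HasTightTranslation linExp (CFG V) (ExplicitSet V) := by
  refine hasTightTranslation_linExp
    (sizeTranslation_four_pow (CFG_alphabetBounded V) (ExplicitSet_expressive V)) 16 fun k =>
    ⟨palGrammar V k, palUCFG_admissible V k, cfgSize_palGrammar_le V k, fun S hS => ?_⟩
  have h := card_le_size_explicitSet (S := S) (ι := List.Vector (Fin 2) k)
    (fun x => palLeft V k x.1 ++ palRight V k x.1) (fun x y hxy => Subtype.ext ?_)
    (fun x => hS ▸ mem_palGrammar_language.2 ⟨x.1, x.2, rfl⟩)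
  · rwa [Nat.card_eq_fintype_card, card_vector, Fintype.card_fin] at h
  · exact palLeft_injective V k (List.append_inj hxy (by simp)).1

theorem tight_DFAs_ExplicitSet (V : Type u) [Infinite V] :
    HasTightTranslation linExp (DFAs V) (ExplicitSet V) := by
  refine hasTightTranslation_linExp
    (sizeTranslation_four_pow (DFAs_alphabetBounded V) (ExplicitSet_expressive V)) 3 fun k =>
    ⟨⟨cubeAutomaton V k, cubeAutomaton_deterministic V k⟩, unionNFA_accepts_admissible,
      size_cubeAutomaton_le V k, fun S hS => ?_⟩
  have h := card_le_size_explicitSet (S := S) _ (segment_bits_injective V k)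
    (fun x => hS ▸ mem_accepts_cubeAutomaton x)
  rwa [Nat.card_eq_fintype_card, Fintype.card_finset, Fintype.card_fin] at h

/-- Passing from `k` to `k + 1` absorbs the summand `1` in the bounds on the number of states. -/
theorem two_pow_le_of_two_pow_succ_le {k s c : ℕ} (h : 2 ^ (k + 1) ≤ c + 1) (hs : c ≤ s) :
    2 ^ k ≤ s := by
  have := Nat.one_le_two_pow (n := k)
  rw [pow_succ] at h
  omega

theorem tight_NFAs_UFAs (V : Type u) [Infinite V] :
    HasTightTranslation polyExp (NFAs V) (UFAs V) := by
  refine hasTightTranslation_polyExp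
    (sizeTranslation_four_pow (NFAs_alphabetBounded V) (UFAs_expressive V)) 24 2 fun k =>
    ⟨meetAutomaton V (k + 1), unionNFA_accepts_admissible,
      size_meetAutomaton_le V k, fun A hA => ?_⟩
  refine two_pow_le_of_two_pow_succ_le (two_pow_le_of_unambiguous A.2
    (fun x => segment V 0 (k + 1) (bits x))
    (fun y => segment V (k + 1) (k + 1) fun p => bits y (p - (k + 1))) fun x y => ?_)
    (card_state_le_size A.1)
  have hA' : A.1.aut.accepts = (meetAutomaton V (k + 1)).aut.accepts := hA
  rw [hA']
  exact mem_accepts_meetAutomaton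

theorem tight_UFAs_DFAs (V : Type u) [Infinite V] :
    HasTightTranslation polyExp (UFAs V) (DFAs V) := by
  refine hasTightTranslation_polyExp
    (sizeTranslation_four_pow (UFAs_alphabetBounded V) (DFAs_expressive V)) 27 3 fun k =>
    ⟨⟨indexAutomaton V (k + 1), indexAutomaton_unambiguous V (k + 1)⟩,
      unionNFA_accepts_admissible, size_indexAutomaton_le V k, fun A hA => ?_⟩
  have hA' : A.1.aut.accepts = (indexAutomaton V (k + 1)).aut.accepts := hA
  have h := card_le_of_residuals A.2 (ι := Finset (Fin (k + 1)))
    (fun x => segment V 0 (k + 1) (bits x)) fun x y hxy => ?_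
  · rw [Nat.card_eq_fintype_card, Fintype.card_finset, Fintype.card_fin] at h
    exact two_pow_le_of_two_pow_succ_le h (card_state_le_size A.1)
  · ext i
    have := hxy (segment V (k + 1) 1 fun _ => i)
    rwa [hA', mem_accepts_indexAutomaton, mem_accepts_indexAutomaton] at this

end SizeTradeoff

theorem mainTheorem3 (V : Type u) [Infinite V] :
    -- exponential translations (E1) to (E8)
    (SizeTradeoff.HasTranslation SizeTradeoff.linExp (SizeTradeoff.CFG V) (SizeTradeoff.NFAs V) ∧
      SizeTradeoff.HasTranslation SizeTradeoff.linExp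
        (SizeTradeoff.UCFG V) (SizeTradeoff.UFAs V) ∧
      SizeTradeoff.HasTranslation SizeTradeoff.linExp
        (SizeTradeoff.CFG V) (SizeTradeoff.UCFG V) ∧
      SizeTradeoff.HasTranslation SizeTradeoff.linExp
        (SizeTradeoff.NFAs V) (SizeTradeoff.UCFG V) ∧
      SizeTradeoff.HasTranslation SizeTradeoff.linExp
        (SizeTradeoff.NFAs V) (SizeTradeoff.UFAs V) ∧
      SizeTradeoff.HasTranslation SizeTradeoff.linExp
        (SizeTradeoff.UFAs V) (SizeTradeoff.DFAs V) ∧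
      SizeTradeoff.HasTranslation SizeTradeoff.linExp
        (SizeTradeoff.DFAs V) (SizeTradeoff.ExplicitSet V) ∧
      SizeTradeoff.HasTranslation SizeTradeoff.linExp
        (SizeTradeoff.CFG V) (SizeTradeoff.ExplicitSet V)) ∧
    -- tightness of (E1), (E2), (E5), (E6), (E7), (E8)
    (SizeTradeoff.HasTightTranslation SizeTradeoff.linExp
        (SizeTradeoff.CFG V) (SizeTradeoff.NFAs V) ∧
      SizeTradeoff.HasTightTranslation SizeTradeoff.linExp
        (SizeTradeoff.UCFG V) (SizeTradeoff.UFAs V) ∧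
      SizeTradeoff.HasTightTranslation SizeTradeoff.polyExp
        (SizeTradeoff.NFAs V) (SizeTradeoff.UFAs V) ∧
      SizeTradeoff.HasTightTranslation SizeTradeoff.polyExp
        (SizeTradeoff.UFAs V) (SizeTradeoff.DFAs V) ∧
      SizeTradeoff.HasTightTranslation SizeTradeoff.linExp
        (SizeTradeoff.DFAs V) (SizeTradeoff.ExplicitSet V) ∧
      SizeTradeoff.HasTightTranslation SizeTradeoff.linExp
        (SizeTradeoff.CFG V) (SizeTradeoff.ExplicitSet V)) := by
  exact ⟨⟨SizeTradeoff.hasTranslation_linExp (SizeTradeoff.CFG_alphabetBounded V)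
      (SizeTradeoff.NFAs_expressive V),
    SizeTradeoff.hasTranslation_linExp (SizeTradeoff.UCFG_alphabetBounded V)
      (SizeTradeoff.UFAs_expressive V),
    SizeTradeoff.hasTranslation_linExp (SizeTradeoff.CFG_alphabetBounded V)
      (SizeTradeoff.UCFG_expressive V),
    SizeTradeoff.hasTranslation_linExp (SizeTradeoff.NFAs_alphabetBounded V)
      (SizeTradeoff.UCFG_expressive V),
    SizeTradeoff.hasTranslation_linExp (SizeTradeoff.NFAs_alphabetBounded V)
      (SizeTradeoff.UFAs_expressive V),
    SizeTradeoff.hasTranslation_linExp (SizeTradeoff.UFAs_alphabetBounded V)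
      (SizeTradeoff.DFAs_expressive V),
    SizeTradeoff.hasTranslation_linExp (SizeTradeoff.DFAs_alphabetBounded V)
      (SizeTradeoff.ExplicitSet_expressive V),
    SizeTradeoff.hasTranslation_linExp (SizeTradeoff.CFG_alphabetBounded V)
      (SizeTradeoff.ExplicitSet_expressive V)⟩,
    ⟨SizeTradeoff.tight_CFG_NFAs V,
    SizeTradeoff.tight_UCFG_UFAs V,
    SizeTradeoff.tight_NFAs_UFAs V,
    SizeTradeoff.tight_UFAs_DFAs V,
    SizeTradeoff.tight_DFAs_ExplicitSet V,
    SizeTradeoff.tight_CFG_ExplicitSet V⟩⟩
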